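/- Let $q$ be an indeterminate, write $[m]_q=(1-q^m)/(1-q)$, $[m]=[m]_q$, $[m]_{q^2}=(1-q^{2m})/(1-q^2)$, $(a;q)_k=(1-a)(1-aq)\cdots(1-aq^{k-1})$, and let $\Phi_n$ be the $n$-th cyclotomic polynomial. Two rational functions $A(q),B(q)\in\mathbb{Q}(q)$ are called congruent modulo a polynomial $P(q)$ if $A(q)-B(q)=N(q)/D(q)$ for polynomials $N,D\in\mathbb{Q}[q]$ with $D\neq 0$, $P\mid N$ and $D$ coprime to $P$. Theorem. Let $n>1$ be an integer with $n\equiv 1\pmod 4$. Then, modulo $[n]_{q^2}\Phi_n(q^2)^2$, $$\sum_{k=0}^{(n-1)/4}[8k+1]_{q^2}[8k+1]^2\frac{(q^2;q^8)_k^4}{(q^8;q^8)_k^4}q^{-4k}\equiv-\frac{2[n]_{q^2}(q^4;q^8)_{(n-1)/4}}{(1+q^2)(q^8;q^8)_{(n-1)/4}}q^{(3-n)/2},$$ $$\sum_{k=0}^{n-1}[8k+1]_{q^2}[8k+1]^2\frac{(q^2;q^8)_k^4}{(q^8;q^8)_k^4}q^{-4k}\equiv-\frac{2[n]_{q^2}(q^4;q^8)_{(n-1)/4}}{(1+q^2)(q^8;q^8)_{(n-1)/4}}q^{(3-n)/2}.$$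 -/

import Mathlib

/-- The `q`-shifted factorial `(a; q)_k = (1 - a) (1 - a q) ⋯ (1 - a q ^ (k - 1))`. -/
def qPochhammer {K : Type*} [Field K] (a q : K) (k : ℕ) : K :=
  ∏ i ∈ Finset.range k, (1 - a * q ^ i)

/-- The `q`-integer `[m]_q = (1 - q ^ m) / (1 - q)`. -/
def qInteger {K : Type*} [Field K] (q : K) (m : ℕ) : K :=
  (1 - q ^ m) / (1 - q)

/-- The polynomial `[n]_{q²} Φ_n(q²)²` in the indeterminate `q`, where
`[n]_{q²} = 1 + q² + ⋯ + q ^ (2 (n - 1))`. -/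
noncomputable def qModulus (n : ℕ) : Polynomial ℚ :=
  (∑ i ∈ Finset.range n, ((Polynomial.X : Polynomial ℚ) ^ 2) ^ i) *
    ((Polynomial.cyclotomic n ℚ).comp (Polynomial.X ^ 2)) ^ 2

/-- Congruence of rational functions modulo a polynomial `P`: the difference can be written as
a fraction whose numerator is divisible by `P` and whose denominator is coprime to `P`. -/
def RatFuncModEq (P : Polynomial ℚ) (A B : RatFunc ℚ) : Prop :=
  ∃ N D : Polynomial ℚ, D ≠ 0 ∧ IsCoprime D P ∧ P ∣ N ∧
    A - B = algebraMap (Polynomial ℚ) (RatFunc ℚ) N / algebraMap (Polynomial ℚ) (RatFunc ℚ) D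

/-- The `k`-th summand
`[8k+1]_{q²} [8k+1]_q² (q²; q⁸)_k⁴ / (q⁸; q⁸)_k⁴ · q ^ (-4k)`. -/
def summandG2 {K : Type*} [Field K] (q : K) (k : ℕ) : K :=
  qInteger (q ^ 2) (8 * k + 1) * qInteger q (8 * k + 1) ^ 2 *
    (qPochhammer (q ^ 2) (q ^ 8) k ^ 4 / qPochhammer (q ^ 8) (q ^ 8) k ^ 4) *
    q ^ (-4 * (k : ℤ))

/-- The closed form
`- 2 [n]_{q²} (q⁴; q⁸)_{(n-1)/4} / ((1 + q²) (q⁸; q⁸)_{(n-1)/4}) · q ^ ((3 - n) / 2)`;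
both divisions of integers are exact when `n ≡ 1 (mod 4)`. -/
def closedFormG2 {K : Type*} [Field K] (q : K) (n : ℕ) : K :=
  -(2 * qInteger (q ^ 2) n * qPochhammer (q ^ 4) (q ^ 8) ((n - 1) / 4) /
      ((1 + q ^ 2) * qPochhammer (q ^ 8) (q ^ 8) ((n - 1) / 4))) *
    q ^ ((3 - (n : ℤ)) / 2)

/-- `1 - q² ≠ 0` for the indeterminate `q`, so that the `q`-integers in base `q²` are genuine
quotients. -/
theorem one_sub_X_sq_ne_zero : (1 - (RatFunc.X : RatFunc ℚ) ^ 2) ≠ 0 := by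
  have h : (1 - (Polynomial.X : Polynomial ℚ) ^ 2) ≠ 0 := by
    intro h
    have := congrArg (Polynomial.eval 0) h
    simp at this
  have h2 := (map_ne_zero_iff _ (RatFunc.algebraMap_injective ℚ)).2 h
  simpa using h2

/-- As a rational function, the modulus is `[n]_{q²} Φ_n(q²)²`. -/
theorem algebraMap_qModulus (n : ℕ) :
    algebraMap (Polynomial ℚ) (RatFunc ℚ) (qModulus n) =
      qInteger ((RatFunc.X : RatFunc ℚ) ^ 2) n *
        Polynomial.aeval ((RatFunc.X : RatFunc ℚ) ^ 2) (Polynomial.cyclotomic n ℚ) ^ 2 := by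
  have hq : qInteger ((RatFunc.X : RatFunc ℚ) ^ 2) n =
      ∑ i ∈ Finset.range n, ((RatFunc.X : RatFunc ℚ) ^ 2) ^ i := by
    rw [qInteger, div_eq_iff one_sub_X_sq_ne_zero, mul_comm, mul_neg_geom_sum]
  have hc : algebraMap (Polynomial ℚ) (RatFunc ℚ)
      ((Polynomial.cyclotomic n ℚ).comp (Polynomial.X ^ 2)) =
      Polynomial.aeval ((RatFunc.X : RatFunc ℚ) ^ 2) (Polynomial.cyclotomic n ℚ) := by
    rw [Polynomial.comp, Polynomial.hom_eval₂, Polynomial.aeval_def]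
    congr 1
    · ext
      simp
    · simp
  rw [hq, qModulus, map_mul, map_pow, hc, map_sum]
  simp

/-! The zeros of the modulus are the ζ for which ζ² is a primitive d-th root of unity with d ∣ n, d
> 1; they are simple for d < n and triple for d = n. The congruences therefore say that sum minus
closed form vanishes at ζ to order 1, respectively 3.

Order 1. Take r < d with d ∣ 4r + 1. At ζ the reflection l ↦ r - l changes the sign of the summand,
and the summands with r < l < d are zero, so the first d terms add up to zero. Later blocks of d
terms are multiples of the first (`hasVal_sum_summandG2`). The closed form vanishes through its
factor [n]_{q²}.

Order 3. Write n = 4m + 1, A = q^(2n) and δ = (1 - A)²/A, which vanishes to order 2. Replacing two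
of the four parameters q² by q²A and q²/A, and two of the q⁸ by q⁸A and q⁸/A, turns the short sum
into a terminating very-well-poised series with an explicit value: the closed form plus a regular
multiple of [n]_{q²} δ, hence correct to order 3 (`sum_summandG2_mul_deformationFactor`). The
replacement multiplies the k-th term by 1 - δ w_k + O(δ²), where w_k is `reflectionWeight`. At ζ the
weight w_k is invariant under k ↦ m - k while the summand is odd, so the sum of their products
vanishes and the δ-term also has order 3. The terms with m < k < n have order 4, so the long sum
satisfies the same congruence. -/

open Polynomial in
/-- `f` is regular at `ζ` and takes the value `c` there. -/
def HasVal {L : Type*} [Field L] [Algebra ℚ L] (ζ : L) (f : RatFunc ℚ) (c : L) : Prop :=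
  ∃ N D : ℚ[X], aeval ζ D ≠ 0 ∧ aeval ζ N = c * aeval ζ D ∧
    f = algebraMap ℚ[X] (RatFunc ℚ) N / algebraMap ℚ[X] (RatFunc ℚ) D

open Polynomial in
/-- `f` is regular at `ζ` and vanishes there to order at least `j`. -/
def VanishesTo {L : Type*} [Field L] [Algebra ℚ L] (ζ : L) (j : ℕ) (f : RatFunc ℚ) : Prop :=
  ∃ N D : ℚ[X], aeval ζ D ≠ 0 ∧ minpoly ℚ ζ ^ j ∣ N ∧
    f = algebraMap ℚ[X] (RatFunc ℚ) N / algebraMap ℚ[X] (RatFunc ℚ) D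

/-! ### Calculus of values and orders of vanishing at a point -/

section Calculus

open Polynomial

variable {L : Type*} [Field L] [Algebra ℚ L] {ζ : L}

theorem algebraMap_ne_zero_of_aeval {D : ℚ[X]} (h : aeval ζ D ≠ 0) :
    algebraMap ℚ[X] (RatFunc ℚ) D ≠ 0 := by
  rw [Ne, map_eq_zero_iff _ (RatFunc.algebraMap_injective ℚ)]
  rintro rfl
  simp at h

theorem HasVal.algebraMap (N : ℚ[X]) :
    HasVal ζ (algebraMap ℚ[X] (RatFunc ℚ) N) (aeval ζ N) :=
  ⟨N, 1, by simp, by simp, by simp⟩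

theorem HasVal.X : HasVal ζ RatFunc.X ζ := by
  simpa using HasVal.algebraMap (ζ := ζ) Polynomial.X

theorem HasVal.zero : HasVal ζ 0 (0 : L) := by
  simpa using HasVal.algebraMap (ζ := ζ) 0

theorem HasVal.one : HasVal ζ 1 (1 : L) := by
  simpa using HasVal.algebraMap (ζ := ζ) 1

theorem HasVal.natCast (k : ℕ) : HasVal ζ (k : RatFunc ℚ) (k : L) := by
  simpa using HasVal.algebraMap (ζ := ζ) (k : ℚ[X])

theorem HasVal.add {f g : RatFunc ℚ} {c d : L} (hf : HasVal ζ f c) (hg : HasVal ζ g d) :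
    HasVal ζ (f + g) (c + d) := by
  obtain ⟨N, D, hD, hN, rfl⟩ := hf
  obtain ⟨N', D', hD', hN', rfl⟩ := hg
  refine ⟨N * D' + D * N', D * D', by simp [hD, hD'], ?_, ?_⟩
  · simp only [map_add, map_mul, hN, hN']
    ring
  · rw [div_add_div _ _ (algebraMap_ne_zero_of_aeval hD) (algebraMap_ne_zero_of_aeval hD')]
    simp

theorem HasVal.mul {f g : RatFunc ℚ} {c d : L} (hf : HasVal ζ f c) (hg : HasVal ζ g d) :
    HasVal ζ (f * g) (c * d) := by
  obtain ⟨N, D, hD, hN, rfl⟩ := hf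
  obtain ⟨N', D', hD', hN', rfl⟩ := hg
  refine ⟨N * N', D * D', by simp [hD, hD'], ?_, ?_⟩
  · simp only [map_mul, hN, hN']
    ring
  · rw [div_mul_div_comm]
    simp

theorem HasVal.neg {f : RatFunc ℚ} {c : L} (hf : HasVal ζ f c) : HasVal ζ (-f) (-c) := by
  obtain ⟨N, D, hD, hN, rfl⟩ := hf
  exact ⟨-N, D, hD, by simp [hN], by simp [neg_div]⟩

theorem HasVal.sub {f g : RatFunc ℚ} {c d : L} (hf : HasVal ζ f c) (hg : HasVal ζ g d) :
    HasVal ζ (f - g) (c - d) := by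
  rw [sub_eq_add_neg, sub_eq_add_neg]
  exact hf.add hg.neg

theorem HasVal.inv {f : RatFunc ℚ} {c : L} (hf : HasVal ζ f c) (hc : c ≠ 0) :
    HasVal ζ f⁻¹ c⁻¹ := by
  obtain ⟨N, D, hD, hN, rfl⟩ := hf
  refine ⟨D, N, ?_, ?_, by simp⟩
  · rw [hN]
    exact mul_ne_zero hc hD
  · rw [hN, inv_mul_cancel_left₀ hc]

theorem HasVal.div {f g : RatFunc ℚ} {c d : L} (hf : HasVal ζ f c) (hg : HasVal ζ g d)
    (hd : d ≠ 0) : HasVal ζ (f / g) (c / d) := by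
  simpa only [div_eq_mul_inv] using hf.mul (hg.inv hd)

theorem HasVal.pow {f : RatFunc ℚ} {c : L} (hf : HasVal ζ f c) (k : ℕ) :
    HasVal ζ (f ^ k) (c ^ k) := by
  induction k with
  | zero => simpa using HasVal.one
  | succ k ih => simpa only [pow_succ] using ih.mul hf

theorem HasVal.zpow {f : RatFunc ℚ} {c : L} (hf : HasVal ζ f c) (hc : c ≠ 0) (k : ℤ) :
    HasVal ζ (f ^ k) (c ^ k) := by
  obtain ⟨k, rfl | rfl⟩ := k.eq_nat_or_neg
  · simpa using hf.pow k
  · simpa using (hf.pow k).inv (pow_ne_zero k hc)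

theorem HasVal.sum {ι : Type*} {s : Finset ι} {f : ι → RatFunc ℚ} {c : ι → L}
    (h : ∀ i ∈ s, HasVal ζ (f i) (c i)) : HasVal ζ (∑ i ∈ s, f i) (∑ i ∈ s, c i) := by
  classical
  induction s using Finset.induction_on with
  | empty => simpa using HasVal.zero
  | insert a s ha ih =>
    rw [Finset.sum_insert ha, Finset.sum_insert ha]
    exact (h a (by simp)).add (ih fun i hi => h i (by simp [hi]))

theorem HasVal.prod {ι : Type*} {s : Finset ι} {f : ι → RatFunc ℚ} {c : ι → L}
    (h : ∀ i ∈ s, HasVal ζ (f i) (c i)) : HasVal ζ (∏ i ∈ s, f i) (∏ i ∈ s, c i) := by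
  classical
  induction s using Finset.induction_on with
  | empty => simpa using HasVal.one
  | insert a s ha ih =>
    rw [Finset.prod_insert ha, Finset.prod_insert ha]
    exact (h a (by simp)).mul (ih fun i hi => h i (by simp [hi]))

theorem HasVal.X_pow (k : ℕ) : HasVal ζ (RatFunc.X ^ k) (ζ ^ k) := HasVal.X.pow k

theorem HasVal.one_sub_X_pow (k : ℕ) : HasVal ζ (1 - RatFunc.X ^ k) (1 - ζ ^ k) :=
  HasVal.one.sub (HasVal.X_pow k)

theorem HasVal.vanishesTo_zero {f : RatFunc ℚ} {c : L} (hf : HasVal ζ f c) :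
    VanishesTo ζ 0 f := by
  obtain ⟨N, D, hD, -, rfl⟩ := hf
  exact ⟨N, D, hD, by simp, rfl⟩

theorem HasVal.vanishesTo_one {f : RatFunc ℚ} (hf : HasVal ζ f 0) : VanishesTo ζ 1 f := by
  obtain ⟨N, D, hD, hN, rfl⟩ := hf
  exact ⟨N, D, hD, by simpa using minpoly.dvd ℚ ζ (by simpa using hN), rfl⟩

theorem VanishesTo.zero (j : ℕ) : VanishesTo ζ j 0 :=
  ⟨0, 1, by simp, by simp, by simp⟩

theorem VanishesTo.add {f g : RatFunc ℚ} {j : ℕ} (hf : VanishesTo ζ j f)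
    (hg : VanishesTo ζ j g) : VanishesTo ζ j (f + g) := by
  obtain ⟨N, D, hD, hN, rfl⟩ := hf
  obtain ⟨N', D', hD', hN', rfl⟩ := hg
  refine ⟨N * D' + D * N', D * D', by simp [hD, hD'], ?_, ?_⟩
  · exact dvd_add (hN.mul_right _) (hN'.mul_left _)
  · rw [div_add_div _ _ (algebraMap_ne_zero_of_aeval hD) (algebraMap_ne_zero_of_aeval hD')]
    simp

theorem VanishesTo.mul {f g : RatFunc ℚ} {j k : ℕ} (hf : VanishesTo ζ j f)
    (hg : VanishesTo ζ k g) : VanishesTo ζ (j + k) (f * g) := by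
  obtain ⟨N, D, hD, hN, rfl⟩ := hf
  obtain ⟨N', D', hD', hN', rfl⟩ := hg
  refine ⟨N * N', D * D', by simp [hD, hD'], ?_, ?_⟩
  · rw [pow_add]
    exact mul_dvd_mul hN hN'
  · rw [div_mul_div_comm]
    simp

theorem VanishesTo.neg {f : RatFunc ℚ} {j : ℕ} (hf : VanishesTo ζ j f) :
    VanishesTo ζ j (-f) := by
  obtain ⟨N, D, hD, hN, rfl⟩ := hf
  exact ⟨-N, D, hD, hN.neg_right, by simp [neg_div]⟩

theorem VanishesTo.sub {f g : RatFunc ℚ} {j : ℕ} (hf : VanishesTo ζ j f)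
    (hg : VanishesTo ζ j g) : VanishesTo ζ j (f - g) := by
  rw [sub_eq_add_neg]
  exact hf.add hg.neg

theorem VanishesTo.mono {f : RatFunc ℚ} {j k : ℕ} (hf : VanishesTo ζ j f) (h : k ≤ j) :
    VanishesTo ζ k f := by
  obtain ⟨N, D, hD, hN, rfl⟩ := hf
  exact ⟨N, D, hD, (pow_dvd_pow _ h).trans hN, rfl⟩

theorem VanishesTo.mul_hasVal {f g : RatFunc ℚ} {j : ℕ} {c : L} (hf : VanishesTo ζ j f)
    (hg : HasVal ζ g c) : VanishesTo ζ j (f * g) := by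
  have h := hf.mul hg.vanishesTo_zero
  rwa [add_zero] at h

theorem VanishesTo.pow {f : RatFunc ℚ} {j : ℕ} (hf : VanishesTo ζ j f) (k : ℕ) :
    VanishesTo ζ (k * j) (f ^ k) := by
  induction k with
  | zero => simpa using (HasVal.one (ζ := ζ)).vanishesTo_zero
  | succ k ih => simpa only [pow_succ, Nat.succ_mul] using ih.mul hf

theorem VanishesTo.sum {ι : Type*} {s : Finset ι} {f : ι → RatFunc ℚ} {j : ℕ}
    (h : ∀ i ∈ s, VanishesTo ζ j (f i)) : VanishesTo ζ j (∑ i ∈ s, f i) := by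
  classical
  induction s using Finset.induction_on with
  | empty => exact VanishesTo.zero j
  | insert a s ha ih =>
    rw [Finset.sum_insert ha]
    exact (h a (by simp)).add (ih fun i hi => h i (by simp [hi]))

/-- Transfers vanishing from an arbitrary representative to the reduced fraction: cross-multiply and
use that D is prime to the irreducible minimal polynomial. If that polynomial divided the reduced
denominator, it would divide the reduced numerator as well. -/
theorem VanishesTo.isCoprime_denom_and_dvd_num {f : RatFunc ℚ} {j : ℕ} (hζ : IsIntegral ℚ ζ)
    (hf : VanishesTo ζ j f) : IsCoprime f.denom (minpoly ℚ ζ) ∧ minpoly ℚ ζ ^ j ∣ f.num := by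
  obtain ⟨N, D, hD, hN, hf⟩ := hf
  have hirr := minpoly.irreducible hζ
  have hco : IsCoprime (minpoly ℚ ζ) D := by
    rw [hirr.coprime_iff_not_dvd]
    intro h
    exact hD (by simpa using (minpoly.dvd_iff (A := ℚ)).1 h)
  have key : f.num * D = N * f.denom := by
    apply RatFunc.algebraMap_injective ℚ
    have h1 := RatFunc.num_div_denom f
    have h2 : algebraMap ℚ[X] (RatFunc ℚ) f.denom ≠ 0 := by
      rw [Ne, map_eq_zero_iff _ (RatFunc.algebraMap_injective ℚ)]
      exact f.denom_ne_zero
    rw [map_mul, map_mul, ← div_eq_div_iff h2 (algebraMap_ne_zero_of_aeval hD), ← hf, h1]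
  refine ⟨?_, hco.pow_left.dvd_of_dvd_mul_right (key ▸ hN.mul_right _)⟩
  rw [isCoprime_comm, hirr.coprime_iff_not_dvd]
  intro h
  have h3 : minpoly ℚ ζ ∣ f.num := hco.dvd_of_dvd_mul_right (key ▸ h.mul_left _)
  exact hirr.not_isUnit ((RatFunc.isCoprime_num_denom f).isUnit_of_dvd' h3 h)

end Calculus

/-! ### Reduction of the congruence to local conditions at roots of unity -/

section Modulus

open Polynomial

theorem cyclotomic_comp_X_sq {d : ℕ} (hd : Odd d) :
    (cyclotomic d ℚ).comp (X ^ 2) = cyclotomic (d * 2) ℚ * cyclotomic d ℚ := by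
  rw [← expand_eq_comp_X_pow, cyclotomic_expand_eq_cyclotomic_mul Nat.prime_two]
  exact hd.not_two_dvd_nat

/-- The geometric sum contributes every Φ_d(q²) with 1 < d ∣ n once; the explicit square raises the
exponent at d = n to 3. -/
theorem qModulus_eq_prod {n : ℕ} (hn : 1 < n) :
    qModulus n = ∏ d ∈ n.divisors.erase 1,
      ((cyclotomic d ℚ).comp (X ^ 2)) ^ (if d = n then 3 else 1) := by
  have hmem : n ∈ n.divisors.erase 1 := by
    rw [Finset.mem_erase, Nat.mem_divisors]
    exact ⟨by omega, dvd_rfl, by omega⟩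
  have h1 : (∑ i ∈ Finset.range n, ((X : ℚ[X]) ^ 2) ^ i) =
      ∏ d ∈ n.divisors.erase 1, (cyclotomic d ℚ).comp (X ^ 2) := by
    have := congrArg (fun p : ℚ[X] => p.comp (X ^ 2))
      (prod_cyclotomic_eq_geom_sum (n := n) (by omega) ℚ)
    simpa [Polynomial.prod_comp, Polynomial.sum_comp] using this.symm
  rw [qModulus, h1, ← Finset.mul_prod_erase _ _ hmem, ← Finset.mul_prod_erase _ _ hmem,
    if_pos rfl]
  have h2 : ∀ d ∈ (n.divisors.erase 1).erase n,
      (cyclotomic d ℚ).comp (X ^ 2) ^ (if d = n then 3 else 1) =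
        (cyclotomic d ℚ).comp (X ^ 2) := by
    intro d hd
    rw [if_neg (Finset.ne_of_mem_erase hd), pow_one]
  rw [Finset.prod_congr rfl h2]
  ring

theorem ratFuncModEq_qModulus {n : ℕ} (hn : 1 < n) (hodd : Odd n) {A B : RatFunc ℚ}
    (h1 : ∀ d, d ∣ n → 1 < d → ∀ ζ : ℂ, ζ ≠ 0 → IsPrimitiveRoot (ζ ^ 2) d →
      VanishesTo ζ 1 (A - B))
    (h3 : ∀ ζ : ℂ, ζ ≠ 0 → IsPrimitiveRoot (ζ ^ 2) n → VanishesTo ζ 3 (A - B)) :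
    RatFuncModEq (qModulus n) A B := by
  have main : ∀ d ∈ n.divisors.erase 1,
      IsCoprime (A - B).denom ((cyclotomic d ℚ).comp (X ^ 2) ^ (if d = n then 3 else 1)) ∧
      (cyclotomic d ℚ).comp (X ^ 2) ^ (if d = n then 3 else 1) ∣ (A - B).num := by
    intro d hd
    simp only [Finset.mem_erase, Nat.mem_divisors] at hd
    have hdn := hd.2.1
    have hd0 : d ≠ 0 := by
      rintro rfl
      exact hd.2.2 (Nat.eq_zero_of_zero_dvd hdn)
    have hdodd : Odd d := hodd.of_dvd_nat hdn
    have key : ∀ e : ℕ, e ≠ 0 → (∀ ζ : ℂ, IsPrimitiveRoot ζ e → IsPrimitiveRoot (ζ ^ 2) d) →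
        IsCoprime (A - B).denom (cyclotomic e ℚ) ∧
        cyclotomic e ℚ ^ (if d = n then 3 else 1) ∣ (A - B).num := by
      intro e he hprim
      have hζ := Complex.isPrimitiveRoot_exp e he
      rw [cyclotomic_eq_minpoly_rat hζ (Nat.pos_of_ne_zero he)]
      apply VanishesTo.isCoprime_denom_and_dvd_num
      · exact (hζ.isIntegral (Nat.pos_of_ne_zero he)).tower_top
      · split_ifs with hdn'
        · exact h3 _ (hζ.ne_zero he) (hdn' ▸ hprim _ hζ)
        · exact h1 d hdn (by omega) _ (hζ.ne_zero he) (hprim _ hζ)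
    -- For odd d, Φ_d(q²) = Φ_d(q) Φ_{2d}(q), so one root of order d and one of order 2d suffice.
    obtain ⟨c1, d1⟩ := key d hd0 fun ζ hζ =>
      hζ.pow_of_coprime 2 hdodd.coprime_two_left
    obtain ⟨c2, d2⟩ := key (d * 2) (by omega) fun ζ hζ =>
      hζ.pow (by omega) (by ring)
    rw [cyclotomic_comp_X_sq hdodd, mul_pow]
    refine ⟨(c2.pow_right).mul_right c1.pow_right, IsCoprime.mul_dvd ?_ d2 d1⟩
    exact (cyclotomic.isCoprime_rat (by omega)).pow
  have hpair : ∀ d ∈ n.divisors.erase 1, ∀ d' ∈ n.divisors.erase 1, d ≠ d' →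
      IsCoprime ((cyclotomic d ℚ).comp (X ^ 2)) ((cyclotomic d' ℚ).comp (X ^ 2)) := by
    intro d _ d' _ hne
    obtain ⟨a, b, hab⟩ := cyclotomic.isCoprime_rat hne
    exact ⟨a.comp (X ^ 2), b.comp (X ^ 2), by
      rw [← mul_comp, ← mul_comp, ← add_comp, hab, one_comp]⟩
  refine ⟨(A - B).num, (A - B).denom, RatFunc.denom_ne_zero _, ?_, ?_,
    (RatFunc.num_div_denom _).symm⟩
  · rw [qModulus_eq_prod hn]
    exact IsCoprime.prod_right fun d hd => (main d hd).1
  · rw [qModulus_eq_prod hn]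
    refine Finset.prod_dvd_of_coprime ?_ fun d hd => (main d hd).2
    intro d hd d' hd' hne
    exact (hpair d hd d' hd' hne).pow

end Modulus

/-! ### Summation of a terminating very-well-poised series -/

section WellPoised

variable {K : Type*} [Field K] {a p e M : K}

/-- The product part of the very-well-poised term with parameters `a`, `a`, `e`, `1 / M` in
base `p`. -/
def wellPoisedProd (a p e M : K) (k : ℕ) : K :=
  ∏ i ∈ Finset.range k, (1 - a * p ^ i) ^ 2 * (1 - e * p ^ i) * (M - p ^ i) * p /
    ((1 - p ^ (i + 1)) ^ 2 * (e - a * p ^ (i + 1)) * (1 - a * M * p ^ (i + 1)))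

/-- The `k`-th term of the very-well-poised `₆φ₅` series with parameters `a`, `a`, `e`, `1 / M`
in base `p`. -/
def wellPoisedTerm (a p e M : K) (k : ℕ) : K :=
  (1 - a * (p ^ k) ^ 2) / (1 - a) * wellPoisedProd a p e M k

theorem wellPoisedProd_succ (k : ℕ) : wellPoisedProd a p e M (k + 1) =
    wellPoisedProd a p e M k * ((1 - a * p ^ k) ^ 2 * (1 - e * p ^ k) * (M - p ^ k) * p /
      ((1 - p ^ (k + 1)) ^ 2 * (e - a * p ^ (k + 1)) * (1 - a * M * p ^ (k + 1)))) :=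
  Finset.prod_range_succ _ _

theorem wellPoisedProd_eq_zero {N k : ℕ} (h : N < k) : wellPoisedProd a p e (p ^ N) k = 0 :=
  Finset.prod_eq_zero (Finset.mem_range.2 h) (by simp)

/-- Passing from M to pM shifts the index in the two factors containing M, so their quotients
telescope and only boundary factors survive. -/
theorem wellPoisedProd_mul_eq (hp : ∀ i, 1 - p ^ (i + 1) ≠ 0)
    (he : ∀ i, e - a * p ^ (i + 1) ≠ 0) (hM : ∀ i, 1 - a * M * p ^ (i + 1) ≠ 0) (k : ℕ) :
    wellPoisedProd a p e M k * (p ^ k * ((p * M - 1) * (1 - a * (p * M)))) =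
      wellPoisedProd a p e (p * M) k * ((p * M - p ^ k) * (1 - a * (p * M) * p ^ k)) := by
  induction k with
  | zero => simp [wellPoisedProd]
  | succ k ih =>
    have h1 := hp k
    have h2 := he k
    have h3 := hM k
    have h4 := hM (k + 1)
    rw [wellPoisedProd_succ, wellPoisedProd_succ]
    have h4' : 1 - a * (p * M) * p ^ (k + 1) ≠ 0 := by
      rwa [show a * (p * M) * p ^ (k + 1) = a * M * p ^ (k + 1 + 1) by ring]
    have h3' : 1 - a * (p * M) * p ^ k = 1 - a * M * p ^ (k + 1) := by ring
    rw [h3'] at ih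
    generalize 1 - a * (p * M) * p ^ (k + 1) = d4 at *
    generalize 1 - a * M * p ^ (k + 1) = d3 at *
    generalize e - a * p ^ (k + 1) = d2 at *
    generalize 1 - p ^ (k + 1) = d1 at *
    generalize wellPoisedProd a p e M k = V at *
    generalize wellPoisedProd a p e (p * M) k = W at *
    generalize hc : (p * M - 1) * (1 - a * (p * M)) = c at *
    rw [pow_succ p k]
    generalize p ^ k = x at *
    field_simp
    have ih' : V * x * c = W * (p * M - x) * d3 := by linear_combination ih
    linear_combination (1 - a * x) ^ 2 * (1 - e * x) * p ^ 2 * (M - x) * ih'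

theorem wellPoisedTerm_mul_eq (hp : ∀ i, 1 - p ^ (i + 1) ≠ 0)
    (he : ∀ i, e - a * p ^ (i + 1) ≠ 0) (hM : ∀ i, 1 - a * M * p ^ (i + 1) ≠ 0) (k : ℕ) :
    wellPoisedTerm a p e M k * (p ^ k * ((p * M - 1) * (1 - a * (p * M)))) =
      wellPoisedTerm a p e (p * M) k * ((p * M - p ^ k) * (1 - a * (p * M) * p ^ k)) := by
  rw [wellPoisedTerm, wellPoisedTerm, mul_assoc, wellPoisedProd_mul_eq hp he hM]
  ring

/-- A telescoping certificate for the first-order recurrence in M: the right side is an explicit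
antidifference in j. It vanishes beyond the end of a terminating series, which leaves the recurrence
for the full sums. -/
theorem sum_wellPoisedTerm_sub (hp0 : p ≠ 0) (ha : 1 - a ≠ 0) (hp : ∀ i, 1 - p ^ (i + 1) ≠ 0)
    (he : ∀ i, e - a * p ^ (i + 1) ≠ 0) (hM : ∀ i, 1 - a * M * p ^ (i + 1) ≠ 0)
    (hM1 : 1 - p * M ≠ 0) (heM : e - a * (p * M) ≠ 0) (j : ℕ) :
    ∑ k ∈ Finset.range j, (wellPoisedTerm a p e (p * M) k -
      (1 - a * (p * M)) * (e - p * M) / ((1 - p * M) * (e - a * (p * M))) *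
        wellPoisedTerm a p e M k) =
    -(p * M) / ((1 - p * M) ^ 2 * (e - a * (p * M))) * (wellPoisedProd a p e (p * M) j / (1 - a)) *
      ((1 - p ^ j) ^ 2 * (e - a * p ^ j) * (1 - a * (p * M) * p ^ j) / p ^ j) := by
  have haM : 1 - a * (p * M) ≠ 0 := by
    have := hM 0
    rwa [show a * M * p ^ (0 + 1) = a * (p * M) by ring] at this
  induction j with
  | zero => simp
  | succ k ih =>
    have h1 := hp k
    have h2 := he k
    have hX : p ^ k ≠ 0 := pow_ne_zero k hp0
    have h4' : 1 - a * (p * M) * p ^ (k + 1) ≠ 0 := by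
      have := hM (k + 1)
      rwa [show a * (p * M) * p ^ (k + 1) = a * M * p ^ (k + 1 + 1) by ring]
    have hA : wellPoisedTerm a p e M k = wellPoisedTerm a p e (p * M) k *
        ((p * M - p ^ k) * (1 - a * (p * M) * p ^ k)) /
        (-(p ^ k * ((1 - p * M) * (1 - a * (p * M))))) := by
      rw [← wellPoisedTerm_mul_eq hp he hM k, eq_div_iff]
      · ring
      · exact neg_ne_zero.2 (mul_ne_zero hX (mul_ne_zero hM1 haM))
    rw [Finset.sum_range_succ, ih, hA, wellPoisedTerm, wellPoisedProd_succ]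
    generalize wellPoisedProd a p e (p * M) k = W
    rw [pow_succ p k] at h1 h2 h4' ⊢
    generalize p ^ k = x at *
    generalize p * M = m at *
    have hr : (1 - a * x) ^ 2 * (1 - e * x) * (m - x) * p /
        ((1 - x * p) ^ 2 * (e - a * (x * p)) * (1 - a * m * (x * p))) *
        ((1 - x * p) ^ 2 * (e - a * (x * p)) * (1 - a * m * (x * p)) / (x * p)) =
        (1 - a * x) ^ 2 * (1 - e * x) * (m - x) / x := by
      generalize 1 - x * p = d1 at *
      generalize e - a * (x * p) = d2 at *
      generalize 1 - a * m * (x * p) = d3 at *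
      field_simp
    rw [mul_assoc (-m / _) (W * _ / _), mul_div_right_comm W, mul_assoc (W / (1 - a)), hr]
    clear hr hA ih h4' h2 h1 hM he hp
    obtain ⟨d1, hd1⟩ : ∃ d, d = 1 - m := ⟨_, rfl⟩
    obtain ⟨d2, hd2⟩ : ∃ d, d = e - a * m := ⟨_, rfl⟩
    obtain ⟨d3, hd3⟩ : ∃ d, d = 1 - a * m := ⟨_, rfl⟩
    obtain ⟨d4, hd4⟩ : ∃ d, d = 1 - a := ⟨_, rfl⟩
    rw [← hd1] at hM1
    rw [← hd2] at heM
    rw [← hd3] at haM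
    rw [← hd4] at ha
    rw [← hd1, ← hd2, ← hd3, ← hd4]
    field_simp
    rw [hd1, hd2]
    ring

theorem sum_wellPoisedTerm (hp0 : p ≠ 0) (ha : 1 - a ≠ 0) (hp : ∀ i, 1 - p ^ (i + 1) ≠ 0)
    (he : ∀ i, e - a * p ^ (i + 1) ≠ 0) (hap : ∀ i, 1 - a * p ^ (i + 1) ≠ 0) (N : ℕ) :
    ∑ k ∈ Finset.range (N + 1), wellPoisedTerm a p e (p ^ N) k =
      ∏ i ∈ Finset.range N, (1 - a * p ^ (i + 1)) * (e - p ^ (i + 1)) /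
        ((1 - p ^ (i + 1)) * (e - a * p ^ (i + 1))) := by
  induction N with
  | zero => simp [wellPoisedTerm, wellPoisedProd, ha]
  | succ N ih =>
    have hM : ∀ i, 1 - a * p ^ N * p ^ (i + 1) ≠ 0 := fun i => by
      have := hap (N + i)
      rwa [show a * p ^ N * p ^ (i + 1) = a * p ^ (N + i + 1) by ring]
    have h := sum_wellPoisedTerm_sub (M := p ^ N) hp0 ha hp he hM
      (by rw [← pow_succ']; exact hp N) (by rw [← pow_succ']; exact he N) (N + 1 + 1)
    rw [← pow_succ', wellPoisedProd_eq_zero (by omega), zero_div, mul_zero, zero_mul,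
      Finset.sum_sub_distrib, ← Finset.mul_sum,
      Finset.sum_range_succ (fun k => wellPoisedTerm a p e (p ^ N) k) (N + 1), ih,
      wellPoisedTerm, wellPoisedProd_eq_zero (by omega), mul_zero, add_zero, sub_eq_zero] at h
    rw [h, Finset.prod_range_succ]
    ring

/-- With x = p^k and y = p^(N+1), (1/x + ax) - (1/y + ay) = (y - x)(1 - axy)/(xy). By
`wellPoisedTerm_mul_eq` this factor lowers M from p^(N+1) to p^N, so the weighted sum is a
combination of two summable series. -/
theorem sum_wellPoisedTerm_mul (hp0 : p ≠ 0) (hp : ∀ i, 1 - p ^ (i + 1) ≠ 0)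
    (he : ∀ i, e - a * p ^ (i + 1) ≠ 0) (hap : ∀ i, 1 - a * p ^ (i + 1) ≠ 0) (s : K) (N : ℕ) :
    ∑ k ∈ Finset.range (N + 1 + 1), wellPoisedTerm a p e (p ^ (N + 1)) k *
        (1 / p ^ k + a * p ^ k - 2 * s) =
      (∑ k ∈ Finset.range (N + 1 + 1), wellPoisedTerm a p e (p ^ (N + 1)) k) *
        (1 / p ^ (N + 1) + a * p ^ (N + 1) - 2 * s) +
      (1 - 1 / p ^ (N + 1)) * (1 - a * p ^ (N + 1)) *
        ∑ k ∈ Finset.range (N + 1), wellPoisedTerm a p e (p ^ N) k := by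
  have h0 : wellPoisedTerm a p e (p ^ N) (N + 1) = 0 := by
    rw [wellPoisedTerm, wellPoisedProd_eq_zero (by omega), mul_zero]
  have h1 : ∑ k ∈ Finset.range (N + 1), wellPoisedTerm a p e (p ^ N) k =
      ∑ k ∈ Finset.range (N + 1 + 1), wellPoisedTerm a p e (p ^ N) k := by
    rw [Finset.sum_range_succ _ (N + 1), h0, add_zero]
  rw [h1, Finset.sum_mul, Finset.mul_sum, ← Finset.sum_add_distrib]
  refine Finset.sum_congr rfl fun k _ => ?_
  have hM : ∀ i, 1 - a * p ^ N * p ^ (i + 1) ≠ 0 := fun i => by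
    have := hap (N + i)
    rwa [show a * p ^ N * p ^ (i + 1) = a * p ^ (N + i + 1) by ring]
  have h := wellPoisedTerm_mul_eq (M := p ^ N) hp he hM k
  rw [← pow_succ'] at h
  have hX : p ^ k ≠ 0 := pow_ne_zero k hp0
  have hY : p ^ (N + 1) ≠ 0 := pow_ne_zero _ hp0
  generalize wellPoisedTerm a p e (p ^ N) k = V at *
  generalize wellPoisedTerm a p e (p ^ (N + 1)) k = W at *
  generalize p ^ k = x at *
  generalize p ^ (N + 1) = y at *
  field_simp
  linear_combination -h

/-- The choice e = a² p^(N+1) makes e · (1/M) = a², so that e and 1/M are deformations of a by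
reciprocal factors. It also simplifies the last factor of the product, so both sums combine. -/
theorem sum_wellPoisedTerm_mul_eq (hp0 : p ≠ 0) (ha0 : a ≠ 0) (ha : 1 - a ≠ 0) (ha' : 1 + a ≠ 0)
    (hp : ∀ i, 1 - p ^ (i + 1) ≠ 0) (hap : ∀ i, 1 - a * p ^ (i + 1) ≠ 0) (s : K) (N : ℕ)
    (he : ∀ i, a ^ 2 * p ^ (N + 1) - a * p ^ (i + 1) ≠ 0) :
    ∑ k ∈ Finset.range (N + 1 + 1), wellPoisedTerm a p (a ^ 2 * p ^ (N + 1)) (p ^ (N + 1)) k *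
        (1 / p ^ k + a * p ^ k - 2 * s) =
      (∏ i ∈ Finset.range (N + 1), (1 - a * p ^ (i + 1)) *
        (a ^ 2 * p ^ (N + 1) - p ^ (i + 1)) /
        ((1 - p ^ (i + 1)) * (a ^ 2 * p ^ (N + 1) - a * p ^ (i + 1)))) *
        (1 / p ^ (N + 1) + a * p ^ (N + 1) - 2 * s -
          (1 - p ^ (N + 1)) ^ 2 * a / (p ^ (N + 1) * (1 + a))) := by
  rw [sum_wellPoisedTerm_mul hp0 hp he hap, sum_wellPoisedTerm hp0 ha hp he hap,
    sum_wellPoisedTerm hp0 ha hp he hap, Finset.prod_range_succ]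
  have h1 := hp N
  have h2 := hap N
  have h3 : a ^ 2 * p ^ (N + 1) - a * p ^ (N + 1) = -(a * p ^ (N + 1) * (1 - a)) := by ring
  have h4 : a ^ 2 * p ^ (N + 1) - p ^ (N + 1) = -(p ^ (N + 1) * (1 - a) * (1 + a)) := by ring
  rw [h3, h4]
  have hY : p ^ (N + 1) ≠ 0 := pow_ne_zero _ hp0
  generalize (∏ i ∈ Finset.range N, ((1 - a * p ^ (i + 1)) *
    (a ^ 2 * p ^ (N + 1) - p ^ (i + 1)) /
    ((1 - p ^ (i + 1)) * (a ^ 2 * p ^ (N + 1) - a * p ^ (i + 1)))) : K) = F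
  generalize p ^ (N + 1) = y at *
  clear he hap hp
  field_simp
  ring

end WellPoised

/-! ### Reflection symmetry at a root of unity -/

section Reflection

variable {K : Type*} [Field K]

/-- The quotient `(q ^ (2 s); q ^ 8)_k / (q ^ 8; q ^ 8)_k`. -/
def pochhammerRatio (q : K) (s k : ℕ) : K :=
  ∏ i ∈ Finset.range k, (1 - q ^ (8 * i + 2 * s)) / (1 - q ^ (8 * i + 8))

/-- The sum over `i < k` of `x / (1 - x) ^ 2` at `x = q ^ (8 i + 2)`, minus the same at
`x = q ^ (8 i + 8)`. -/
def reflectionWeight (q : K) (k : ℕ) : K :=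
  ∑ i ∈ Finset.range k, (q ^ (8 * i + 2) / (1 - q ^ (8 * i + 2)) ^ 2 -
    q ^ (8 * i + 8) / (1 - q ^ (8 * i + 8)) ^ 2)

theorem pochhammerRatio_eq (q : K) (s k : ℕ) : pochhammerRatio q s k =
    qPochhammer (q ^ (2 * s)) (q ^ 8) k / qPochhammer (q ^ 8) (q ^ 8) k := by
  rw [pochhammerRatio, qPochhammer, qPochhammer, ← Finset.prod_div_distrib]
  refine Finset.prod_congr rfl fun i _ => ?_
  ring_nf

theorem summandG2_eq (q : K) (k : ℕ) : summandG2 q k =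
    (1 - q ^ (16 * k + 2)) / (1 - q ^ 2) * ((1 - q ^ (8 * k + 1)) / (1 - q)) ^ 2 *
      pochhammerRatio q 1 k ^ 4 * (q ^ (4 * k))⁻¹ := by
  rw [summandG2, qInteger, qInteger, pochhammerRatio_eq, div_pow, mul_one, ← pow_mul, neg_mul,
    zpow_neg]
  norm_cast
  ring_nf

variable {q : K} {r : ℕ}

/-- For t = r - l - 1 the hypothesis makes q^(8t+2) and q^(8t+8) the inverses of q^(8l+8) and
q^(8l+2). Each step thus exchanges numerator and denominator at the cost of a factor q⁶. -/
theorem pochhammerRatio_reflect (hr : q ^ (8 * r + 2) = 1)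
    (h2 : ∀ i < r, 1 - q ^ (8 * i + 2) ≠ 0) (h8 : ∀ i < r, 1 - q ^ (8 * i + 8) ≠ 0)
    {l : ℕ} (hl : l ≤ r) : pochhammerRatio q 1 (r - l) =
      pochhammerRatio q 1 r * q ^ (6 * l) * pochhammerRatio q 1 l := by
  induction l with
  | zero => simp [pochhammerRatio]
  | succ l ih =>
    obtain ⟨t, rfl⟩ : ∃ t, r = l + 1 + t := ⟨r - (l + 1), by omega⟩
    have ih := ih (by omega)
    rw [show l + 1 + t - l = t + 1 by omega] at ih
    rw [show l + 1 + t - (l + 1) = t by omega]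
    have hA := h2 l (by omega)
    have hB := h8 l (by omega)
    have hq : q ≠ 0 := by
      rintro rfl
      simp at hr
    have e1 : q ^ (8 * t + 2) = (q ^ (8 * l + 8))⁻¹ := by
      refine eq_inv_of_mul_eq_one_left ?_
      rw [← hr]
      ring
    have e2 : q ^ (8 * t + 8) = (q ^ (8 * l + 2))⁻¹ := by
      refine eq_inv_of_mul_eq_one_left ?_
      rw [← hr]
      ring
    have hx2 : q ^ (8 * l + 2) ≠ 0 := pow_ne_zero _ hq
    have hx8 : q ^ (8 * l + 8) = q ^ (8 * l + 2) * q ^ 6 := by ring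
    rw [pochhammerRatio, Finset.prod_range_succ, ← pochhammerRatio, mul_one, e1, e2] at ih
    rw [pochhammerRatio.eq_1 q 1 (l + 1), Finset.prod_range_succ, ← pochhammerRatio, mul_one,
      show q ^ (6 * (l + 1)) = q ^ (6 * l) * q ^ 6 by ring]
    have hA' : 1 - (q ^ (8 * l + 2))⁻¹ = -(1 - q ^ (8 * l + 2)) / q ^ (8 * l + 2) := by
      field_simp
      ring
    have hB' : 1 - (q ^ (8 * l + 8))⁻¹ = -(1 - q ^ (8 * l + 8)) / q ^ (8 * l + 8) := by
      have := pow_ne_zero (8 * l + 8) hq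
      field_simp
      ring
    rw [hA', hB', hx8] at ih
    rw [hx8] at hB ⊢
    generalize q ^ (8 * l + 2) = x at *
    have hq6 := pow_ne_zero 6 hq
    generalize q ^ 6 = y at *
    generalize 1 - x * y = d1 at *
    generalize 1 - x = d2 at *
    generalize pochhammerRatio q 1 t = P at *
    generalize pochhammerRatio q 1 l = P' at *
    generalize pochhammerRatio q 1 (l + 1 + t) = P'' at *
    field_simp at ih ⊢
    linear_combination ih

theorem reflectionWeight_reflect_aux (hr : q ^ (8 * r + 2) = 1) {l : ℕ} (hl : l ≤ r) :
    reflectionWeight q (r - l) = reflectionWeight q r + reflectionWeight q l := by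
  -- Invariance under inversion is what makes the weight even under reflection.
  have hinv : ∀ x : K, x⁻¹ / (1 - x⁻¹) ^ 2 = x / (1 - x) ^ 2 := by
    intro x
    by_cases hx : x = 0
    · simp [hx]
    · rw [show 1 - x⁻¹ = -(1 - x) / x by field_simp; ring, div_pow, neg_sq, div_div_eq_mul_div]
      congr 1
      field_simp
  induction l with
  | zero => simp [reflectionWeight]
  | succ l ih =>
    obtain ⟨t, rfl⟩ : ∃ t, r = l + 1 + t := ⟨r - (l + 1), by omega⟩
    have ih := ih (by omega)
    rw [show l + 1 + t - l = t + 1 by omega] at ih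
    rw [show l + 1 + t - (l + 1) = t by omega]
    have hq : q ≠ 0 := by
      rintro rfl
      simp at hr
    have e1 : q ^ (8 * t + 2) = (q ^ (8 * l + 8))⁻¹ := by
      refine eq_inv_of_mul_eq_one_left ?_
      rw [← hr]
      ring
    have e2 : q ^ (8 * t + 8) = (q ^ (8 * l + 2))⁻¹ := by
      refine eq_inv_of_mul_eq_one_left ?_
      rw [← hr]
      ring
    rw [reflectionWeight, Finset.sum_range_succ, ← reflectionWeight, e1, e2, hinv, hinv] at ih
    rw [reflectionWeight.eq_1 q (l + 1), Finset.sum_range_succ, ← reflectionWeight]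
    linear_combination ih

theorem reflectionWeight_reflect [CharZero K] (hr : q ^ (8 * r + 2) = 1) {l : ℕ}
    (hl : l ≤ r) : reflectionWeight q (r - l) = reflectionWeight q l := by
  have h := reflectionWeight_reflect_aux hr le_rfl
  -- Taking l = r gives 0 = 2 · `reflectionWeight q r`.
  rw [Nat.sub_self, reflectionWeight, Finset.sum_range_zero, ← two_mul, zero_eq_mul] at h
  rw [reflectionWeight_reflect_aux hr hl, h.resolve_left two_ne_zero, zero_add]

theorem summandG2_reflect (hr : q ^ (8 * r + 2) = 1)
    (h2 : ∀ i < r, 1 - q ^ (8 * i + 2) ≠ 0) (h8 : ∀ i < r, 1 - q ^ (8 * i + 8) ≠ 0)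
    {l : ℕ} (hl : l ≤ r) : summandG2 q (r - l) = -summandG2 q l := by
  have hrr := pochhammerRatio_reflect hr h2 h8 le_rfl
  rw [Nat.sub_self, pochhammerRatio, Finset.prod_range_zero] at hrr
  rw [summandG2_eq, summandG2_eq, pochhammerRatio_reflect hr h2 h8 hl]
  obtain ⟨t, rfl⟩ : ∃ t, r = l + t := ⟨r - l, by omega⟩
  rw [show l + t - l = t by omega]
  have hq : q ≠ 0 := by
    rintro rfl
    simp at hr
  rw [show q ^ (6 * (l + t)) = (q ^ (4 * l)) * q ^ (2 * l) * (q ^ (4 * t) * q ^ (2 * t)) by ring]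
    at hrr
  rw [show q ^ (8 * (l + t) + 2) = (q ^ (4 * l)) ^ 2 * (q ^ (4 * t)) ^ 2 * q ^ 2 by ring] at hr
  rw [show q ^ (16 * t + 2) = (q ^ (4 * t)) ^ 4 * q ^ 2 by ring,
    show q ^ (16 * l + 2) = (q ^ (4 * l)) ^ 4 * q ^ 2 by ring,
    show q ^ (8 * t + 1) = (q ^ (4 * t)) ^ 2 * q by ring,
    show q ^ (8 * l + 1) = (q ^ (4 * l)) ^ 2 * q by ring,
    show q ^ (6 * l) = (q ^ (4 * l)) * q ^ (2 * l) by ring]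
  have e1 : (q ^ (2 * l)) ^ 2 = q ^ (4 * l) := by ring
  have e2 : (q ^ (2 * t)) ^ 2 = q ^ (4 * t) := by ring
  generalize pochhammerRatio q 1 (l + t) = P at *
  generalize pochhammerRatio q 1 l = P' at *
  have hy := pow_ne_zero (4 * l) hq
  have hw := pow_ne_zero (4 * t) hq
  generalize q ^ (4 * l) = y at *
  generalize q ^ (4 * t) = w at *
  generalize q ^ (2 * l) = y' at *
  generalize q ^ (2 * t) = w' at *
  -- The ratio reflection at l = r reads P² q^(6r) = 1, and yw = q^(4r).
  have hP : P ^ 4 = ((y * w) ^ 3)⁻¹ := by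
    refine eq_inv_of_mul_eq_one_left ?_
    calc P ^ 4 * (y * w) ^ 3 = P ^ 4 * (y * w) ^ 2 * (y * w) := by ring
      _ = P ^ 4 * (y * w) ^ 2 * (y' ^ 2 * w' ^ 2) := by rw [e1, e2]
      _ = (P * (y * y' * (w * w')) * P) ^ 2 := by ring
      _ = 1 := by rw [← hrr, one_pow]
  have hw2 : w ^ 2 = (y ^ 2 * q ^ 2)⁻¹ := by
    refine eq_inv_of_mul_eq_one_left ?_
    rw [← hr]
    ring
  have key : (1 - w ^ 4 * q ^ 2) * (1 - w ^ 2 * q) ^ 2 * (y ^ 6 * ((y * w) ^ 3)⁻¹) * w⁻¹ =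
      -((1 - y ^ 4 * q ^ 2) * (1 - y ^ 2 * q) ^ 2 * y⁻¹) := by
    rw [show y ^ 6 * ((y * w) ^ 3)⁻¹ = y ^ 3 * (w ^ 3)⁻¹ by field_simp,
      show ∀ A B : K, A * B * (y ^ 3 * (w ^ 3)⁻¹) * w⁻¹ = A * B * (y ^ 3 * ((w ^ 2) ^ 2)⁻¹) by
        intro A B; field_simp, show w ^ 4 = (w ^ 2) ^ 2 by ring, hw2]
    field_simp
    ring
  calc _ = (1 - w ^ 4 * q ^ 2) * (1 - w ^ 2 * q) ^ 2 * ((y ^ 4 * y' ^ 4) * P ^ 4) * w⁻¹ *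
        (P' ^ 4 * ((1 - q ^ 2)⁻¹ * (1 - q)⁻¹ ^ 2)) := by ring
    _ = (1 - w ^ 4 * q ^ 2) * (1 - w ^ 2 * q) ^ 2 * (y ^ 6 * ((y * w) ^ 3)⁻¹) * w⁻¹ *
        (P' ^ 4 * ((1 - q ^ 2)⁻¹ * (1 - q)⁻¹ ^ 2)) := by
      rw [hP, ← e1]
      ring
    _ = _ := by
      rw [key]
      ring

theorem sum_eq_zero_of_antisymm [CharZero K] {f : ℕ → K}
    (hf : ∀ l ≤ r, f (r - l) = -f l) : ∑ l ∈ Finset.range (r + 1), f l = 0 := by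
  have h := Finset.sum_range_reflect f (r + 1)
  rw [Finset.sum_congr rfl (g := fun l => -f l), Finset.sum_neg_distrib] at h
  · exact self_eq_neg.1 h.symm
  · intro l hl
    rw [Finset.mem_range] at hl
    rw [show r + 1 - 1 - l = r - l by omega, hf l (by omega)]

theorem sum_summandG2_eq_zero [CharZero K] (hr : q ^ (8 * r + 2) = 1)
    (h2 : ∀ i < r, 1 - q ^ (8 * i + 2) ≠ 0) (h8 : ∀ i < r, 1 - q ^ (8 * i + 8) ≠ 0) :
    ∑ l ∈ Finset.range (r + 1), summandG2 q l = 0 :=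
  sum_eq_zero_of_antisymm fun _ hl => summandG2_reflect hr h2 h8 hl

theorem sum_summandG2_mul_reflectionWeight_eq_zero [CharZero K] (hr : q ^ (8 * r + 2) = 1)
    (h2 : ∀ i < r, 1 - q ^ (8 * i + 2) ≠ 0) (h8 : ∀ i < r, 1 - q ^ (8 * i + 8) ≠ 0) :
    ∑ l ∈ Finset.range (r + 1), summandG2 q l * reflectionWeight q l = 0 :=
  sum_eq_zero_of_antisymm fun _ hl => by
    rw [summandG2_reflect hr h2 h8 hl, reflectionWeight_reflect hr hl, neg_mul]

end Reflection

/-! ### Blocks of terms and vanishing to first order -/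

section RootOfUnity

theorem one_sub_X_pow_ne_zero {k : ℕ} (hk : k ≠ 0) : 1 - (RatFunc.X : RatFunc ℚ) ^ k ≠ 0 := by
  have h : (1 - (Polynomial.X : Polynomial ℚ) ^ k) ≠ 0 := by
    intro h
    have := congrArg (Polynomial.eval 0) h
    simp [hk] at this
  have h2 := (map_ne_zero_iff _ (RatFunc.algebraMap_injective ℚ)).2 h
  simpa using h2

variable {L : Type*} [Field L] {ζ : L} {d m : ℕ}

theorem IsPrimitiveRoot.sq_pow_eq_one_iff (hζ : IsPrimitiveRoot (ζ ^ 2) d) {j k : ℕ}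
    (hk : k = 2 * j) : ζ ^ k = 1 ↔ d ∣ j := by
  rw [hk, pow_mul, hζ.pow_eq_one_iff_dvd]

theorem IsPrimitiveRoot.one_sub_sq_pow_ne_zero (hζ : IsPrimitiveRoot (ζ ^ 2) d) {j k : ℕ}
    (hk : k = 2 * j) (h : ¬ d ∣ j) : 1 - ζ ^ k ≠ 0 := by
  rw [sub_ne_zero, ne_comm, Ne, hζ.sq_pow_eq_one_iff hk]
  exact h

theorem IsPrimitiveRoot.sq_pow_add (hζ : IsPrimitiveRoot (ζ ^ 2) d) (j k t : ℕ) :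
    ζ ^ (2 * t * (j * d) + k) = ζ ^ k := by
  rw [pow_add, (hζ.sq_pow_eq_one_iff (j := t * (j * d)) (by ring)).2 ⟨t * j, by ring⟩, one_mul]

theorem not_dvd_four_mul (hd : d ∣ 4 * m + 1) {j : ℕ} (hj : 0 < j) (hjd : j < d) :
    ¬ d ∣ 4 * j := by
  intro h
  have hco : Nat.Coprime d 4 := by
    refine Nat.Coprime.coprime_dvd_left hd ?_
    simp
  exact Nat.not_dvd_of_pos_of_lt hj hjd (hco.dvd_of_dvd_mul_left h)

theorem not_dvd_of_lt_mod (hd : d ∣ 4 * m + 1) {r i : ℕ} (hr : d ∣ 4 * r + 1) (hrd : r < d)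
    (hi : i < r) : ¬ d ∣ 4 * i + 1 := by
  intro h
  refine not_dvd_four_mul hd (j := r - i) (by omega) (by omega) ?_
  have := Nat.dvd_sub hr h
  rwa [show 4 * r + 1 - (4 * i + 1) = 4 * (r - i) by omega] at this

theorem IsPrimitiveRoot.ne_one_of_sq (hd1 : 1 < d) (hζ : IsPrimitiveRoot (ζ ^ 2) d) : ζ ≠ 1 := by
  rintro rfl
  rw [one_pow, IsPrimitiveRoot.one_left_iff] at hζ
  omega

theorem IsPrimitiveRoot.one_add_sq_ne_zero (hd : d ∣ 4 * m + 1) (hd1 : 1 < d)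
    (hζ : IsPrimitiveRoot (ζ ^ 2) d) : 1 + ζ ^ 2 ≠ 0 := by
  intro h
  have h4 : ζ ^ 4 = 1 := by linear_combination (ζ ^ 2 - 1) * h
  rw [hζ.sq_pow_eq_one_iff (j := 2) rfl] at h4
  have h5 := (Nat.dvd_add_right (h4.mul_left (2 * m))).1 (by rwa [show 2 * m * 2 = 4 * m by ring])
  rw [Nat.dvd_one] at h5
  omega

theorem sum_range_summandG2_eq_zero [CharZero L] (hd : d ∣ 4 * m + 1)
    (hζ : IsPrimitiveRoot (ζ ^ 2) d) {r l : ℕ} (hr : d ∣ 4 * r + 1) (hrl : r < l) (hl : l ≤ d) :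
    ∑ k ∈ Finset.range l, summandG2 ζ k = 0 := by
  have hr1 : ζ ^ (8 * r + 2) = 1 := (hζ.sq_pow_eq_one_iff (by ring)).2 hr
  rw [← sum_summandG2_eq_zero hr1
    (fun i hi => hζ.one_sub_sq_pow_ne_zero (j := 4 * i + 1) (by ring)
      (not_dvd_of_lt_mod hd hr (by omega) hi))
    (fun i hi => hζ.one_sub_sq_pow_ne_zero (j := 4 * (i + 1)) (by ring)
      (not_dvd_four_mul hd (by omega) (by omega)))]
  refine (Finset.sum_subset (Finset.range_subset_range.2 (by omega)) fun k _ hk => ?_).symm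
  rw [Finset.mem_range] at hk
  rw [summandG2_eq, pochhammerRatio,
    Finset.prod_eq_zero (i := r) (Finset.mem_range.2 (by omega)) (by simp [hr1])]
  simp

variable [Algebra ℚ L]

theorem hasVal_one_sub_div_one_sub [CharZero L] (hd1 : 1 < d) (hζ : IsPrimitiveRoot (ζ ^ 2) d)
    (a b : ℕ) (hb : b ≠ 0) :
    HasVal ζ ((1 - RatFunc.X ^ (2 * d * a)) / (1 - RatFunc.X ^ (2 * d * b))) ((a : L) / b) := by
  have hX := one_sub_X_pow_ne_zero (k := 2 * d) (by omega)
  have key : ∀ k : ℕ, HasVal ζ (∑ i ∈ Finset.range k, ((RatFunc.X : RatFunc ℚ) ^ (2 * d)) ^ i)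
      (k : L) := by
    intro k
    have h := HasVal.sum (ζ := ζ) (s := Finset.range k) fun i _ =>
      (HasVal.X_pow (ζ := ζ) (2 * d)).pow i
    simpa [(hζ.sq_pow_eq_one_iff (k := 2 * d) rfl).2 dvd_rfl] using h
  rw [pow_mul _ (2 * d) a, pow_mul _ (2 * d) b, ← mul_neg_geom_sum _ a, ← mul_neg_geom_sum _ b,
    mul_div_mul_left _ _ hX]
  exact (key a).div (key b) (Nat.cast_ne_zero.2 hb)

/-- Over one period the denominator vanishes at ζ only for i = d - 1, and some numerator factor
vanishes too. Pairing these two gives a regular quotient by `hasVal_one_sub_div_one_sub`. -/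
theorem exists_hasVal_pochhammerRatio_block [CharZero L] (hd : d ∣ 4 * m + 1) (hd1 : 1 < d)
    (hζ : IsPrimitiveRoot (ζ ^ 2) d) (s j : ℕ) :
    ∃ γ : L, HasVal ζ (∏ i ∈ Finset.range d, (1 - (RatFunc.X : RatFunc ℚ) ^
      (8 * (j * d + i) + 2 * s)) / (1 - RatFunc.X ^ (8 * (j * d + i) + 8))) γ := by
  obtain ⟨e, rfl⟩ : ∃ e, d = e + 1 := ⟨d - 1, by omega⟩
  have hi0 : s * m % (e + 1) ∈ Finset.range (e + 1) :=
    Finset.mem_range.2 (Nat.mod_lt _ (by omega))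
  -- The vanishing numerator sits at i ≡ sm, because 4sm + s = s(4m + 1).
  obtain ⟨a, ha⟩ : e + 1 ∣ 4 * (j * (e + 1) + s * m % (e + 1)) + s := by
    have h1 : e + 1 ∣ s * (4 * m + 1) := hd.mul_left s
    have h2 := Nat.div_add_mod (s * m) (e + 1)
    have h3 : s * (4 * m + 1) = (e + 1) * (4 * (s * m / (e + 1))) +
        (4 * (s * m % (e + 1)) + s) := by
      rw [show s * (4 * m + 1) = 4 * (s * m) + s by ring]
      conv_lhs => rw [← h2]
      ring
    rw [h3, Nat.dvd_add_right (Dvd.intro _ rfl)] at h1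
    rw [mul_add, add_assoc]
    exact dvd_add ⟨4 * j, by ring⟩ h1
  rw [Finset.prod_div_distrib, Finset.prod_range_succ (fun i => 1 - RatFunc.X ^ (_ + 8)),
    ← Finset.prod_erase_mul _ _ hi0, mul_div_mul_comm,
    show 8 * (j * (e + 1) + s * m % (e + 1)) + 2 * s = 2 * (e + 1) * a by linarith,
    show 8 * (j * (e + 1) + e) + 8 = 2 * (e + 1) * (4 * (j + 1)) by ring]
  refine ⟨_, ((HasVal.prod fun i _ => HasVal.one_sub_X_pow _).div
    (HasVal.prod fun i _ => HasVal.one_sub_X_pow _) ?_).mul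
    (hasVal_one_sub_div_one_sub hd1 hζ a _ (by omega))⟩
  refine Finset.prod_ne_zero_iff.2 fun i hi => ?_
  rw [Finset.mem_range] at hi
  refine hζ.one_sub_sq_pow_ne_zero (j := 4 * j * (e + 1) + 4 * (i + 1)) (by ring) ?_
  rw [Nat.dvd_add_right (Dvd.intro_left _ rfl)]
  exact not_dvd_four_mul hd (by omega) (by omega)

theorem hasVal_pochhammerRatio_block (hd : d ∣ 4 * m + 1)
    (hζ : IsPrimitiveRoot (ζ ^ 2) d) (s j : ℕ) {l : ℕ} (hl : l < d) :
    HasVal ζ (∏ i ∈ Finset.range l, (1 - (RatFunc.X : RatFunc ℚ) ^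
      (8 * (j * d + i) + 2 * s)) / (1 - RatFunc.X ^ (8 * (j * d + i) + 8)))
      (pochhammerRatio ζ s l) := by
  refine HasVal.prod fun i hi => ?_
  rw [Finset.mem_range] at hi
  have h1 := HasVal.one_sub_X_pow (ζ := ζ) (8 * (j * d + i) + 2 * s)
  have h2 := HasVal.one_sub_X_pow (ζ := ζ) (8 * (j * d + i) + 8)
  have e1 := hζ.sq_pow_add j (8 * i + 2 * s) 4
  have e2 := hζ.sq_pow_add j (8 * i + 8) 4
  rw [show 2 * 4 * (j * d) + (8 * i + 2 * s) = 8 * (j * d + i) + 2 * s by ring] at e1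
  rw [show 2 * 4 * (j * d) + (8 * i + 8) = 8 * (j * d + i) + 8 by ring] at e2
  rw [e1] at h1
  rw [e2] at h2
  exact h1.div h2 (hζ.one_sub_sq_pow_ne_zero (j := 4 * (i + 1)) (by ring)
    (not_dvd_four_mul hd (by omega) (by omega)))

theorem exists_hasVal_pochhammerRatio [CharZero L] (hd : d ∣ 4 * m + 1) (hd1 : 1 < d)
    (hζ : IsPrimitiveRoot (ζ ^ 2) d) (s j : ℕ) :
    ∃ γ : L, ∀ l < d, HasVal ζ (pochhammerRatio RatFunc.X s (j * d + l))
      (γ * pochhammerRatio ζ s l) := by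
  suffices h : ∃ γ : L, HasVal ζ (pochhammerRatio RatFunc.X s (j * d)) γ by
    obtain ⟨γ, hγ⟩ := h
    refine ⟨γ, fun l hl => ?_⟩
    rw [pochhammerRatio.eq_1 RatFunc.X, Finset.prod_range_add]
    exact hγ.mul (hasVal_pochhammerRatio_block hd hζ s j hl)
  induction j with
  | zero => exact ⟨1, by simpa [pochhammerRatio] using HasVal.one⟩
  | succ j ih =>
    obtain ⟨γ, hγ⟩ := ih
    obtain ⟨γ', hγ'⟩ := exists_hasVal_pochhammerRatio_block hd hd1 hζ s j
    refine ⟨γ * γ', ?_⟩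
    rw [Nat.succ_mul, pochhammerRatio, Finset.prod_range_add]
    exact hγ.mul hγ'

/-- The constant γ does not depend on l, so the vanishing of the first block carries over to block
j. -/
theorem exists_hasVal_summandG2 [CharZero L] (hζ0 : ζ ≠ 0) (hd : d ∣ 4 * m + 1) (hd1 : 1 < d)
    (hζ : IsPrimitiveRoot (ζ ^ 2) d) (j : ℕ) :
    ∃ γ : L, ∀ l < d, HasVal ζ (summandG2 RatFunc.X (j * d + l)) (γ * summandG2 ζ l) := by
  obtain ⟨γ, hγ⟩ := exists_hasVal_pochhammerRatio hd hd1 hζ 1 j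
  refine ⟨γ ^ 4, fun l hl => ?_⟩
  have h1 := HasVal.one_sub_X_pow (ζ := ζ) (16 * (j * d + l) + 2)
  have h2 := HasVal.one_sub_X_pow (ζ := ζ) (8 * (j * d + l) + 1)
  have h3 := HasVal.X_pow (ζ := ζ) (4 * (j * d + l))
  have e1 := hζ.sq_pow_add j (16 * l + 2) 8
  have e2 := hζ.sq_pow_add j (8 * l + 1) 4
  have e3 := hζ.sq_pow_add j (4 * l) 2
  rw [show 2 * 8 * (j * d) + (16 * l + 2) = 16 * (j * d + l) + 2 by ring] at e1
  rw [show 2 * 4 * (j * d) + (8 * l + 1) = 8 * (j * d + l) + 1 by ring] at e2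
  rw [show 2 * 2 * (j * d) + 4 * l = 4 * (j * d + l) by ring] at e3
  rw [e1] at h1
  rw [e2] at h2
  rw [e3] at h3
  have h4 := (((h1.div (HasVal.one_sub_X_pow 2) (hζ.one_sub_sq_pow_ne_zero (j := 1) rfl
    (by rw [Nat.dvd_one]; omega))).mul ((h2.div (HasVal.one.sub HasVal.X)
    (sub_ne_zero.2 (hζ.ne_one_of_sq hd1).symm)).pow 2)).mul ((hγ l hl).pow 4)).mul
    (h3.inv (pow_ne_zero _ hζ0))
  rw [← summandG2_eq] at h4
  convert h4 using 1
  rw [summandG2_eq]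
  ring

theorem hasVal_sum_summandG2 [CharZero L] (hζ0 : ζ ≠ 0) (hd : d ∣ 4 * m + 1) (hd1 : 1 < d)
    (hζ : IsPrimitiveRoot (ζ ^ 2) d) {r : ℕ} (hr : d ∣ 4 * r + 1) (j : ℕ) {l : ℕ}
    (hrl : r < l) (hl : l ≤ d) :
    HasVal ζ (∑ k ∈ Finset.range (j * d + l), summandG2 RatFunc.X k) 0 := by
  have block : ∀ j l, r < l → l ≤ d →
      HasVal ζ (∑ k ∈ Finset.range l, summandG2 RatFunc.X (j * d + k)) 0 := by
    intro j l hrl hl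
    obtain ⟨γ, hγ⟩ := exists_hasVal_summandG2 hζ0 hd hd1 hζ j
    have h := HasVal.sum fun k hk => hγ k ((Finset.mem_range.1 hk).trans_le hl)
    rwa [← Finset.mul_sum, sum_range_summandG2_eq_zero hd hζ hr hrl hl, mul_zero] at h
  have full : HasVal ζ (∑ k ∈ Finset.range (j * d), summandG2 RatFunc.X k) 0 := by
    induction j with
    | zero => simpa using HasVal.zero
    | succ j ih =>
      rw [Nat.succ_mul, Finset.sum_range_add]
      simpa using ih.add (block j d (by omega) le_rfl)
  rw [Finset.sum_range_add]
  simpa using full.add (block j l hrl hl)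

theorem closedFormG2_eq {K : Type*} [Field K] (q : K) (n : ℕ) : closedFormG2 q n =
    -(2 * qInteger (q ^ 2) n * pochhammerRatio q 2 ((n - 1) / 4) * (1 + q ^ 2)⁻¹ *
      q ^ ((3 - (n : ℤ)) / 2)) := by
  rw [closedFormG2, pochhammerRatio_eq]
  field_simp

theorem exists_hasVal_pochhammerRatio_at [CharZero L] (hd : d ∣ 4 * m + 1) (hd1 : 1 < d)
    (hζ : IsPrimitiveRoot (ζ ^ 2) d) (s k : ℕ) :
    ∃ γ : L, HasVal ζ (pochhammerRatio RatFunc.X s k) γ := by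
  obtain ⟨γ, hγ⟩ := exists_hasVal_pochhammerRatio hd hd1 hζ s (k / d)
  have := hγ (k % d) (Nat.mod_lt _ (by omega))
  rw [Nat.div_add_mod'] at this
  exact ⟨_, this⟩

theorem hasVal_qInteger_sq (hd1 : 1 < d) (hζ : IsPrimitiveRoot (ζ ^ 2) d) {n : ℕ} (hn : d ∣ n) :
    HasVal ζ (qInteger (RatFunc.X ^ 2) n) 0 := by
  have h := (HasVal.one_sub_X_pow (ζ := ζ) (2 * n)).div (HasVal.one_sub_X_pow 2)
    (hζ.one_sub_sq_pow_ne_zero (j := 1) rfl (by rw [Nat.dvd_one]; omega))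
  rwa [(hζ.sq_pow_eq_one_iff rfl).2 hn, sub_self, zero_div, pow_mul] at h

theorem hasVal_closedFormG2 [CharZero L] (hζ0 : ζ ≠ 0) (hd : d ∣ 4 * m + 1) (hd1 : 1 < d)
    (hζ : IsPrimitiveRoot (ζ ^ 2) d) : HasVal ζ (closedFormG2 RatFunc.X (4 * m + 1)) 0 := by
  rw [closedFormG2_eq]
  obtain ⟨γ, hγ⟩ := exists_hasVal_pochhammerRatio_at hd hd1 hζ 2 ((4 * m + 1 - 1) / 4)
  have h := (((((HasVal.natCast (ζ := ζ) 2).mul (hasVal_qInteger_sq hd1 hζ hd)).mul hγ).mul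
    ((HasVal.one.add (HasVal.X_pow 2)).inv (hζ.one_add_sq_ne_zero hd hd1))).mul
    (HasVal.X.zpow hζ0 ((3 - ((4 * m + 1 : ℕ) : ℤ)) / 2))).neg
  simpa using h

theorem hasVal_sub_closedFormG2 [CharZero L] (hζ0 : ζ ≠ 0) (hd : d ∣ 4 * m + 1) (hd1 : 1 < d)
    (hζ : IsPrimitiveRoot (ζ ^ 2) d) :
    HasVal ζ ((∑ k ∈ Finset.range (m + 1), summandG2 RatFunc.X k) -
      closedFormG2 RatFunc.X (4 * m + 1)) 0 ∧
    HasVal ζ ((∑ k ∈ Finset.range (4 * m + 1), summandG2 RatFunc.X k) -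
      closedFormG2 RatFunc.X (4 * m + 1)) 0 := by
  have hc := hasVal_closedFormG2 hζ0 hd hd1 hζ
  have hlt := Nat.mod_lt m (show d > 0 by omega)
  have hr : d ∣ 4 * (m % d) + 1 := by
    have h2 := Nat.div_add_mod m d
    rw [← h2, show 4 * (d * (m / d) + m % d) + 1 = d * (4 * (m / d)) + (4 * (m % d) + 1) by ring,
      Nat.dvd_add_right (Dvd.intro _ rfl)] at hd
    simpa using hd
  constructor
  -- The short sum ends with a partial block of m % d + 1 terms, just long enough to contain the
  -- whole antisymmetric range with r = m % d.
  · have h := hasVal_sum_summandG2 hζ0 hd hd1 hζ hr (m / d) (Nat.lt_succ_self _) hlt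
    rw [Nat.succ_eq_add_one, ← add_assoc, Nat.div_add_mod'] at h
    simpa using h.sub hc
  · obtain ⟨c, hcd⟩ := id hd
    obtain ⟨c, rfl⟩ : ∃ e, c = e + 1 := ⟨c - 1, by
      rcases c with _ | c
      · omega
      · rfl⟩
    have h := hasVal_sum_summandG2 hζ0 hd hd1 hζ hr c hlt le_rfl
    rw [show c * d + d = 4 * m + 1 by rw [hcd]; ring] at h
    simpa using h.sub hc

end RootOfUnity

/-! ### Deformation in δ and vanishing to third order -/

section Deformation

/-- The factor by which the `k`-th summand changes when the parameters `q ^ 2`, `q ^ 2` and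
`q ^ 8`, `q ^ 8` in base `q ^ 8` are multiplied by `A` and by `1 / A`, in terms of
`δ = (1 - A) ^ 2 / A`. -/
def deformationFactor {K : Type*} [Field K] (q δ : K) (k : ℕ) : K :=
  ∏ i ∈ Finset.range k, (1 - δ * (q ^ (8 * i + 2) / (1 - q ^ (8 * i + 2)) ^ 2)) /
    (1 - δ * (q ^ (8 * i + 8) / (1 - q ^ (8 * i + 8)) ^ 2))

section Field

variable {K : Type*} [Field K] {q : K} {m : ℕ}

theorem wellPoisedProd_eq_deformationFactor (hq0 : q ≠ 0) (hq : ∀ i, i ≠ 0 → 1 - q ^ i ≠ 0)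
    (k : ℕ) :
    wellPoisedProd (q ^ 2) (q ^ 8) ((q ^ 2) ^ 2 * (q ^ 8) ^ m) ((q ^ 8) ^ m) k =
      pochhammerRatio q 1 k ^ 4 * deformationFactor q ((1 - q ^ (8 * m + 2)) ^ 2 /
        q ^ (8 * m + 2)) k * q ^ (4 * k) := by
  -- A and 1/A enter symmetrically, so a deformed pair of factors depends on A only through δ.
  have hfac : ∀ u A : K, 1 - u ≠ 0 → A ≠ 0 →
      (1 - u) ^ 2 * (1 - (1 - A) ^ 2 / A * (u / (1 - u) ^ 2)) = (1 - u * A) * (1 - u / A) := by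
    intro u A hu hA
    field_simp
    ring
  have hA : q ^ (8 * m + 2) ≠ 0 := pow_ne_zero _ hq0
  rw [wellPoisedProd, pochhammerRatio, deformationFactor, ← Finset.prod_pow, pow_mul,
    ← Finset.card_range k, ← Finset.prod_const, Finset.card_range, ← Finset.prod_mul_distrib,
    ← Finset.prod_mul_distrib]
  refine Finset.prod_congr rfl fun i _ => ?_
  have hu := hq (8 * i + 2) (by omega)
  have hv := hq (8 * i + 8) (by omega)
  have hfu := hfac _ _ hu hA
  have hfv := hfac _ _ hv hA
  have hM : (q ^ 8) ^ m ≠ 0 := pow_ne_zero _ (pow_ne_zero _ hq0)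
  rw [mul_one, div_pow, div_mul_div_comm,
    show (1 - q ^ (8 * i + 2)) ^ 4 = (1 - q ^ (8 * i + 2)) ^ 2 * (1 - q ^ (8 * i + 2)) ^ 2 by ring,
    show (1 - q ^ (8 * i + 8)) ^ 4 = (1 - q ^ (8 * i + 8)) ^ 2 * (1 - q ^ (8 * i + 8)) ^ 2 by ring,
    mul_assoc ((1 - q ^ (8 * i + 2)) ^ 2), mul_assoc ((1 - q ^ (8 * i + 8)) ^ 2), hfu, hfv]
  have e1 : q ^ (8 * i + 2) = q ^ 2 * (q ^ 8) ^ i := by ring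
  have e2 : q ^ (8 * i + 8) = q ^ 8 * (q ^ 8) ^ i := by ring
  have e3 : q ^ (8 * m + 2) = q ^ 2 * (q ^ 8) ^ m := by ring
  rw [e2] at hv
  rw [e1, e2, e3, pow_succ' (q ^ 8) i]
  generalize (q ^ 8) ^ m = M at *
  generalize (q ^ 8) ^ i = x at *
  have f1 : M - x = M * (1 - q ^ 2 * x / (q ^ 2 * M)) := by
    field_simp
  have f2 : (q ^ 2) ^ 2 * M - q ^ 2 * (q ^ 8 * x) =
      (q ^ 2) ^ 2 * M * (1 - q ^ 8 * x / (q ^ 2 * M)) := by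
    field_simp
  rw [f1, f2, show q ^ 2 * M * (q ^ 8 * x) = q ^ 8 * x * (q ^ 2 * M) by ring,
    show (q ^ 2) ^ 2 * M * x = q ^ 2 * x * (q ^ 2 * M) by ring]
  generalize 1 - q ^ 2 * x / (q ^ 2 * M) = c1
  generalize 1 - q ^ 8 * x / (q ^ 2 * M) = c2
  generalize 1 - q ^ 8 * x * (q ^ 2 * M) = c3
  generalize 1 - q ^ 2 * x * (q ^ 2 * M) = c4
  generalize 1 - q ^ 8 * x = c5 at *
  calc _ = (1 - q ^ 2 * x) ^ 2 * (c4 * c1) / (c5 ^ 2 * (c3 * c2)) *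
        (M * q ^ 8 / ((q ^ 2) ^ 2 * M)) := by
        rw [div_mul_div_comm]
        congr 1 <;> ring
    _ = _ := by
        congr 1
        field_simp

/-- With a = q², s = q and x = q^(8k), the weight 1/x + ax - 2s equals (1 - qx)²/x, which supplies
the factor [8k+1]². -/
theorem summandG2_mul_deformationFactor (hq0 : q ≠ 0) (hq : ∀ i, i ≠ 0 → 1 - q ^ i ≠ 0)
    (k : ℕ) :
    summandG2 q k * deformationFactor q ((1 - q ^ (8 * m + 2)) ^ 2 / q ^ (8 * m + 2)) k =
      wellPoisedTerm (q ^ 2) (q ^ 8) ((q ^ 2) ^ 2 * (q ^ 8) ^ m) ((q ^ 8) ^ m) k *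
        (1 / (q ^ 8) ^ k + q ^ 2 * (q ^ 8) ^ k - 2 * q) / (1 - q) ^ 2 := by
  rw [wellPoisedTerm, wellPoisedProd_eq_deformationFactor hq0 hq, summandG2_eq]
  have h1 : 1 - q ≠ 0 := by simpa using hq 1 one_ne_zero
  have h2 := hq 2 two_ne_zero
  rw [show q ^ (16 * k + 2) = (q ^ (4 * k)) ^ 4 * q ^ 2 by ring,
    show q ^ (8 * k + 1) = (q ^ (4 * k)) ^ 2 * q by ring,
    show (q ^ 8) ^ k = (q ^ (4 * k)) ^ 2 by ring]
  have hy : q ^ (4 * k) ≠ 0 := pow_ne_zero _ hq0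
  generalize deformationFactor q _ k = D
  generalize pochhammerRatio q 1 k = P
  generalize q ^ (4 * k) = y at *
  field_simp
  ring

theorem prod_range_wellPoised (hq0 : q ≠ 0) (hq : ∀ i, i ≠ 0 → 1 - q ^ i ≠ 0) (m : ℕ) :
    ∏ i ∈ Finset.range m, (1 - q ^ 2 * (q ^ 8) ^ (i + 1)) *
        ((q ^ 2) ^ 2 * (q ^ 8) ^ m - (q ^ 8) ^ (i + 1)) /
        ((1 - (q ^ 8) ^ (i + 1)) * ((q ^ 2) ^ 2 * (q ^ 8) ^ m - q ^ 2 * (q ^ 8) ^ (i + 1))) =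
      qInteger (q ^ 2) (4 * m + 1) * pochhammerRatio q 2 m * (q ^ (2 * m))⁻¹ := by
  have h2 := hq 2 two_ne_zero
  have hrefl : ∏ i ∈ Finset.range m, ((q ^ 2) ^ 2 * (q ^ 8) ^ m - (q ^ 8) ^ (i + 1)) /
      ((q ^ 2) ^ 2 * (q ^ 8) ^ m - q ^ 2 * (q ^ 8) ^ (i + 1)) =
      ∏ i ∈ Finset.range m, (1 - q ^ (8 * i + 4)) / (q ^ 2 * (1 - q ^ (8 * i + 2))) := by
    -- Reversing the order of the factors removes m from the exponents.
    rw [← Finset.prod_range_reflect]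
    refine Finset.prod_congr rfl fun i hi => ?_
    rw [Finset.mem_range] at hi
    obtain ⟨t, rfl⟩ : ∃ t, m = i + t + 1 := ⟨m - i - 1, by omega⟩
    rw [show i + t + 1 - 1 - i + 1 = t + 1 by omega,
      show (q ^ 2) ^ 2 * (q ^ 8) ^ (i + t + 1) - (q ^ 8) ^ (t + 1) =
        -(q ^ 8) ^ (t + 1) * (1 - q ^ (8 * i + 4)) by ring,
      show (q ^ 2) ^ 2 * (q ^ 8) ^ (i + t + 1) - q ^ 2 * (q ^ 8) ^ (t + 1) =
        -(q ^ 8) ^ (t + 1) * (q ^ 2 * (1 - q ^ (8 * i + 2))) by ring,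
      mul_div_mul_left _ _ (neg_ne_zero.2 (pow_ne_zero _ (pow_ne_zero _ hq0)))]
  -- The factors 1 - q^(8i+10) over 1 - q^(8i+2) telescope to the q-integer.
  have htel : ∀ k, ∏ i ∈ Finset.range k,
      (1 - q ^ 2 * (q ^ 8) ^ (i + 1)) / (1 - q ^ (8 * i + 2)) =
      qInteger (q ^ 2) (4 * k + 1) := by
    intro k
    induction k with
    | zero => simp [qInteger, h2]
    | succ k ih =>
      have := hq (8 * k + 2) (by omega)
      rw [Finset.prod_range_succ, ih, qInteger, qInteger,
        show (q ^ 2) ^ (4 * k + 1) = q ^ (8 * k + 2) by ring,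
        show (q ^ 2) ^ (4 * (k + 1) + 1) = q ^ 2 * (q ^ 8) ^ (k + 1) by ring,
        div_mul_div_comm, mul_comm (1 - q ^ (8 * k + 2)), mul_div_mul_right _ _ this]
  have hpow : (q ^ (2 * m))⁻¹ = ∏ _i ∈ Finset.range m, (q ^ 2)⁻¹ := by
    rw [Finset.prod_const, Finset.card_range, inv_pow, ← pow_mul]
  rw [← htel, pochhammerRatio, hpow, ← Finset.prod_mul_distrib, ← Finset.prod_mul_distrib]
  rw [Finset.prod_congr rfl fun i _ => mul_div_mul_comm _ _ _ _, Finset.prod_mul_distrib, hrefl,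
    ← Finset.prod_mul_distrib]
  refine Finset.prod_congr rfl fun i _ => ?_
  rw [show (q ^ 8) ^ (i + 1) = q ^ (8 * i + 8) by ring, mul_comm (q ^ 2) (1 - q ^ (8 * i + 2))]
  generalize 1 - q ^ (8 * i + 2) = a
  generalize 1 - q ^ (8 * i + 8) = b
  simp only [div_eq_mul_inv, mul_inv]
  ring

theorem sum_summandG2_mul_deformationFactor (hq0 : q ≠ 0) (hq : ∀ i, i ≠ 0 → 1 - q ^ i ≠ 0)
    (hm : m ≠ 0) {δ : K} (hδ : δ = (1 - q ^ (8 * m + 2)) ^ 2 / q ^ (8 * m + 2)) :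
    ∑ k ∈ Finset.range (m + 1), summandG2 q k * deformationFactor q δ k =
      closedFormG2 q (4 * m + 1) + qInteger (q ^ 2) (4 * m + 1) * δ *
        (pochhammerRatio q 2 m * (q ^ (2 * m))⁻¹ * q ^ 2 * ((1 + q ^ 2) * (1 - q) ^ 2)⁻¹) := by
  have h1 : 1 - q ≠ 0 := by simpa using hq 1 one_ne_zero
  have h2 := hq 2 two_ne_zero
  have h4 : 1 + q ^ 2 ≠ 0 := fun h => hq 4 four_ne_zero (by linear_combination (1 - q ^ 2) * h)
  obtain ⟨N, rfl⟩ := Nat.exists_eq_succ_of_ne_zero hm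
  have hsum := sum_wellPoisedTerm_mul_eq (pow_ne_zero 8 hq0) (pow_ne_zero 2 hq0) h2 h4
    (fun i => by rw [← pow_mul]; exact hq _ (by omega))
    (fun i => by rw [← pow_mul, ← pow_add]; exact hq _ (by omega)) q N (fun i => by
      rcases le_total i N with h | h
      · obtain ⟨t, rfl⟩ := Nat.exists_eq_add_of_le h
        rw [show (q ^ 2) ^ 2 * (q ^ 8) ^ (i + t + 1) - q ^ 2 * (q ^ 8) ^ (i + 1) =
          -(q ^ (8 * i + 10) * (1 - q ^ (8 * t + 2))) by ring]
        exact neg_ne_zero.2 (mul_ne_zero (pow_ne_zero _ hq0) (hq _ (by omega)))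
      · obtain ⟨t, rfl⟩ := Nat.exists_eq_add_of_le h
        rcases t with _ | t
        · rw [show (q ^ 2) ^ 2 * (q ^ 8) ^ (N + 1) - q ^ 2 * (q ^ 8) ^ (N + 0 + 1) =
            -(q ^ (8 * N + 10) * (1 - q ^ 2)) by ring]
          exact neg_ne_zero.2 (mul_ne_zero (pow_ne_zero _ hq0) h2)
        · rw [show (q ^ 2) ^ 2 * (q ^ 8) ^ (N + 1) - q ^ 2 * (q ^ 8) ^ (N + (t + 1) + 1) =
            q ^ (8 * N + 12) * (1 - q ^ (8 * t + 6)) by ring]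
          exact mul_ne_zero (pow_ne_zero _ hq0) (hq _ (by omega)))
  rw [prod_range_wellPoised hq0 hq] at hsum
  rw [Finset.sum_congr rfl fun k _ => by rw [hδ, summandG2_mul_deformationFactor hq0 hq],
    ← Finset.sum_div, hsum, closedFormG2_eq,
    show (4 * (N + 1) + 1 - 1) / 4 = N + 1 by omega,
    show (3 - ((4 * (N + 1) + 1 : ℕ) : ℤ)) / 2 = 1 - (2 * (N + 1) : ℕ) by push_cast; omega,
    zpow_sub₀ hq0, zpow_one, zpow_natCast, hδ,
    show q ^ (8 * (N + 1) + 2) = q ^ 2 * (q ^ 8) ^ (N + 1) by ring]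
  have hM : (q ^ 8) ^ (N + 1) ≠ 0 := pow_ne_zero _ (pow_ne_zero _ hq0)
  have hM' : q ^ (2 * (N + 1)) ≠ 0 := pow_ne_zero _ hq0
  generalize (q ^ 8) ^ (N + 1) = M at *
  generalize q ^ (2 * (N + 1)) = M' at *
  generalize pochhammerRatio q 2 (N + 1) = P
  generalize qInteger (q ^ 2) (4 * (N + 1) + 1) = I
  clear hsum hq
  field_simp
  ring

end Field

variable {L : Type*} [Field L] [Algebra ℚ L] {ζ : L} {m : ℕ}

theorem HasVal.div_one_sub_sq {f : RatFunc ℚ} {c : L} (hf : HasVal ζ f c) (hc : 1 - c ≠ 0) :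
    HasVal ζ (f / (1 - f) ^ 2) (c / (1 - c) ^ 2) :=
  hf.div ((HasVal.one.sub hf).pow 2) (pow_ne_zero 2 hc)

theorem hasVal_reflectionWeight {k : ℕ} (h2 : ∀ i < k, 1 - ζ ^ (8 * i + 2) ≠ 0)
    (h8 : ∀ i < k, 1 - ζ ^ (8 * i + 8) ≠ 0) :
    HasVal ζ (reflectionWeight RatFunc.X k) (reflectionWeight ζ k) := by
  refine HasVal.sum fun i hi => ?_
  rw [Finset.mem_range] at hi
  exact ((HasVal.X_pow _).div_one_sub_sq (h2 i hi)).sub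
    ((HasVal.X_pow _).div_one_sub_sq (h8 i hi))

theorem vanishesTo_deformationFactor_sub {δ : RatFunc ℚ} (hδ : VanishesTo ζ 2 δ)
    (hδ0 : HasVal ζ δ 0) {k : ℕ} (h2 : ∀ i < k, 1 - ζ ^ (8 * i + 2) ≠ 0)
    (h8 : ∀ i < k, 1 - ζ ^ (8 * i + 8) ≠ 0) :
    VanishesTo ζ 4 (deformationFactor RatFunc.X δ k -
      (1 - δ * reflectionWeight RatFunc.X k)) := by
  induction k with
  | zero => simpa [deformationFactor, reflectionWeight] using VanishesTo.zero (ζ := ζ) 4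
  | succ k ih =>
    have ih := ih (fun i hi => h2 i (by omega)) (fun i hi => h8 i (by omega))
    have hh := hasVal_reflectionWeight (fun i hi => h2 i (Nat.lt_succ_of_lt hi))
      (fun i hi => h8 i (Nat.lt_succ_of_lt hi))
    have hu := (HasVal.X_pow _).div_one_sub_sq (h2 k (Nat.lt_succ_self k))
    have hv := (HasVal.X_pow _).div_one_sub_sq (h8 k (Nat.lt_succ_self k))
    rw [deformationFactor, Finset.prod_range_succ, ← deformationFactor, reflectionWeight,
      Finset.sum_range_succ, ← reflectionWeight]
    generalize deformationFactor (RatFunc.X : RatFunc ℚ) δ k = D at *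
    generalize reflectionWeight (RatFunc.X : RatFunc ℚ) k = H at *
    generalize (RatFunc.X : RatFunc ℚ) ^ (8 * k + 2) / (1 - RatFunc.X ^ (8 * k + 2)) ^ 2 = u at *
    generalize (RatFunc.X : RatFunc ℚ) ^ (8 * k + 8) / (1 - RatFunc.X ^ (8 * k + 8)) ^ 2 = v at *
    have hdv : HasVal ζ (1 - δ * v) 1 := by simpa using HasVal.one.sub (hδ0.mul hv)
    have hne : 1 - δ * v ≠ 0 := by
      obtain ⟨N, D, hD, hN, h⟩ := hdv
      rw [h]
      exact div_ne_zero (algebraMap_ne_zero_of_aeval (ζ := ζ) (by rwa [hN, one_mul]))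
        (algebraMap_ne_zero_of_aeval hD)
    -- The new error is the old one times a regular factor plus δ² times a regular function.
    have key : D * ((1 - δ * u) / (1 - δ * v)) - (1 - δ * (H + (u - v))) =
        (D - (1 - δ * H)) * ((1 - δ * u) / (1 - δ * v)) +
        δ ^ 2 * (H * (u - v) - (1 - δ * H) * (v * (u - v) / (1 - δ * v))) := by
      field_simp
      ring
    rw [key]
    exact (ih.mul_hasVal ((HasVal.one.sub (hδ0.mul hu)).div hdv one_ne_zero)).add
      ((hδ.pow 2).mul_hasVal ((hh.mul (hu.sub hv)).sub
        ((HasVal.one.sub (hδ0.mul hh)).mul ((hv.mul (hu.sub hv)).div hdv one_ne_zero))))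

/-- For k > m the factor 1 - q^(8m+2) makes the Pochhammer ratio vanish at ζ, and this ratio enters
to the fourth power. -/
theorem hasVal_summandG2 [CharZero L] (hζ0 : ζ ≠ 0) (hm : m ≠ 0)
    (hζ : IsPrimitiveRoot (ζ ^ 2) (4 * m + 1)) {k : ℕ} (hk : k < 4 * m + 1) :
    HasVal ζ (summandG2 RatFunc.X k) (summandG2 ζ k) ∧
      (m < k → VanishesTo ζ 4 (summandG2 RatFunc.X k)) := by
  have h0 : pochhammerRatio ζ 1 k = 0 ∨ k ≤ m := by
    rw [or_iff_not_imp_right, not_le]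
    intro hmk
    rw [pochhammerRatio,
      Finset.prod_eq_zero (i := m) (Finset.mem_range.2 hmk)]
    rw [(hζ.sq_pow_eq_one_iff (k := 8 * m + 2 * 1) (by ring)).2 dvd_rfl]
    simp
  have hP := hasVal_pochhammerRatio_block dvd_rfl hζ 1 0 hk
  simp only [zero_mul, zero_add] at hP
  rw [← pochhammerRatio] at hP
  have h1 := ((HasVal.one_sub_X_pow (ζ := ζ) (16 * k + 2)).div (HasVal.one_sub_X_pow 2)
    (hζ.one_sub_sq_pow_ne_zero (j := 1) rfl (by rw [Nat.dvd_one]; omega))).mul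
    (((HasVal.one_sub_X_pow (8 * k + 1)).div (HasVal.one.sub HasVal.X)
    (sub_ne_zero.2 (hζ.ne_one_of_sq (by omega)).symm)).pow 2)
  have h2 := (HasVal.X_pow (ζ := ζ) (4 * k)).inv (pow_ne_zero _ hζ0)
  rw [summandG2_eq, summandG2_eq]
  refine ⟨(h1.mul (hP.pow 4)).mul h2, fun hmk => ?_⟩
  rw [h0.resolve_right (by omega)] at hP
  rw [mul_comm (_ * _) (pochhammerRatio _ _ _ ^ 4)]
  exact ((hP.vanishesTo_one.pow 4).mul_hasVal h1).mul_hasVal h2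

theorem vanishesTo_sub_closedFormG2 [CharZero L] (hζ0 : ζ ≠ 0) (hm : m ≠ 0)
    (hζ : IsPrimitiveRoot (ζ ^ 2) (4 * m + 1)) :
    VanishesTo ζ 3 ((∑ k ∈ Finset.range (m + 1), summandG2 RatFunc.X k) -
      closedFormG2 RatFunc.X (4 * m + 1)) ∧
    VanishesTo ζ 3 ((∑ k ∈ Finset.range (4 * m + 1), summandG2 RatFunc.X k) -
      closedFormG2 RatFunc.X (4 * m + 1)) := by
  have hr : ζ ^ (8 * m + 2) = 1 := (hζ.sq_pow_eq_one_iff (by ring)).2 dvd_rfl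
  have h2 : ∀ i < m, 1 - ζ ^ (8 * i + 2) ≠ 0 := fun i hi =>
    hζ.one_sub_sq_pow_ne_zero (j := 4 * i + 1) (by ring)
      (not_dvd_of_lt_mod dvd_rfl dvd_rfl (by omega) hi)
  have h8 : ∀ i < m, 1 - ζ ^ (8 * i + 8) ≠ 0 := fun i hi =>
    hζ.one_sub_sq_pow_ne_zero (j := 4 * (i + 1)) (by ring)
      (not_dvd_four_mul dvd_rfl (by omega) (by omega))
  obtain ⟨δ, hδdef⟩ : ∃ δ : RatFunc ℚ,
    δ = (1 - RatFunc.X ^ (8 * m + 2)) ^ 2 / RatFunc.X ^ (8 * m + 2) := ⟨_, rfl⟩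
  have hA : HasVal ζ (1 - RatFunc.X ^ (8 * m + 2)) 0 := by
    simpa [hr] using HasVal.one_sub_X_pow (ζ := ζ) (8 * m + 2)
  have hA' := (HasVal.X_pow (ζ := ζ) (8 * m + 2)).inv (pow_ne_zero _ hζ0)
  have hδ : VanishesTo ζ 2 δ := by
    rw [hδdef, div_eq_mul_inv]
    exact (hA.vanishesTo_one.pow 2).mul_hasVal hA'
  have hδ0 : HasVal ζ δ 0 := by
    rw [hδdef, div_eq_mul_inv]
    simpa using (hA.pow 2).mul hA'
  have hX : (RatFunc.X : RatFunc ℚ) ≠ 0 := RatFunc.X_ne_zero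
  have hexact := sum_summandG2_mul_deformationFactor hX
    (fun i hi => one_sub_X_pow_ne_zero hi) hm hδdef
  have hweight : HasVal ζ (∑ k ∈ Finset.range (m + 1), summandG2 RatFunc.X k *
      reflectionWeight RatFunc.X k) 0 := by
    rw [← sum_summandG2_mul_reflectionWeight_eq_zero hr h2 h8]
    refine HasVal.sum fun k hk => ?_
    rw [Finset.mem_range] at hk
    exact (hasVal_summandG2 hζ0 hm hζ (by omega)).1.mul
      (hasVal_reflectionWeight (fun i hi => h2 i (by omega)) (fun i hi => h8 i (by omega)))
  have hrest : VanishesTo ζ 4 (∑ k ∈ Finset.range (m + 1), (deformationFactor RatFunc.X δ k -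
      (1 - δ * reflectionWeight RatFunc.X k)) * summandG2 RatFunc.X k) := by
    refine VanishesTo.sum fun k hk => ?_
    rw [Finset.mem_range] at hk
    exact (vanishesTo_deformationFactor_sub hδ hδ0 (fun i hi => h2 i (by omega))
      (fun i hi => h8 i (by omega))).mul_hasVal (hasVal_summandG2 hζ0 hm hζ (by omega)).1
  obtain ⟨γ, hγ⟩ := exists_hasVal_pochhammerRatio_at dvd_rfl (by omega) hζ 2 m
  have herr := ((hasVal_qInteger_sq (by omega) hζ dvd_rfl).vanishesTo_one.mul hδ).mul_hasVal
    (((hγ.mul ((HasVal.X_pow (2 * m)).inv (pow_ne_zero _ hζ0))).mul (HasVal.X_pow 2)).mul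
      (((HasVal.one.add (HasVal.X_pow 2)).mul ((HasVal.one.sub HasVal.X).pow 2)).inv
        (mul_ne_zero (hζ.one_add_sq_ne_zero dvd_rfl (by omega)) (pow_ne_zero 2
          (sub_ne_zero.2 (hζ.ne_one_of_sq (by omega)).symm)))))
  have hshort : VanishesTo ζ 3 ((∑ k ∈ Finset.range (m + 1), summandG2 RatFunc.X k) -
      closedFormG2 RatFunc.X (4 * m + 1)) := by
    have h := ((herr.mono (k := 3) (by norm_num)).add
      ((hδ.mul hweight.vanishesTo_one).mono (k := 3) (by norm_num))).sub
      (hrest.mono (k := 3) (by norm_num))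
    convert h using 1
    -- Solving this for the undeformed sum leaves three errors, of orders 1 + 2, 2 + 1 and 4.
    have hsplit : ∑ k ∈ Finset.range (m + 1), (deformationFactor RatFunc.X δ k -
        (1 - δ * reflectionWeight RatFunc.X k)) * summandG2 RatFunc.X k =
        ∑ k ∈ Finset.range (m + 1), summandG2 RatFunc.X k * deformationFactor RatFunc.X δ k -
        ∑ k ∈ Finset.range (m + 1), summandG2 RatFunc.X k +
        δ * ∑ k ∈ Finset.range (m + 1), summandG2 RatFunc.X k * reflectionWeight RatFunc.X k := by
      rw [Finset.mul_sum, ← Finset.sum_sub_distrib, ← Finset.sum_add_distrib]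
      exact Finset.sum_congr rfl fun k _ => by ring
    rw [hsplit, hexact]
    ring
  refine ⟨hshort, ?_⟩
  rw [show 4 * m + 1 = m + 1 + 3 * m by ring, Finset.sum_range_add,
    show m + 1 + 3 * m = 4 * m + 1 by ring, add_sub_right_comm]
  refine hshort.add (VanishesTo.sum fun k hk => ?_)
  rw [Finset.mem_range] at hk
  exact ((hasVal_summandG2 hζ0 hm hζ (by omega)).2 (by omega)).mono (by norm_num)

end Deformation

/-! ### The two congruences -/

theorem theorem2 (n : ℕ) (hn : n ≡ 1 [MOD 4]) (hn1 : 1 < n) :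
    RatFuncModEq (qModulus n)
      (∑ k ∈ Finset.range ((n - 1) / 4 + 1), summandG2 (RatFunc.X : RatFunc ℚ) k)
      (closedFormG2 (RatFunc.X : RatFunc ℚ) n) ∧
    RatFuncModEq (qModulus n)
      (∑ k ∈ Finset.range n, summandG2 (RatFunc.X : RatFunc ℚ) k)
      (closedFormG2 (RatFunc.X : RatFunc ℚ) n) := by
  obtain ⟨m, rfl⟩ : ∃ m, n = 4 * m + 1 := ⟨n / 4, by
    have : n % 4 = 1 := hn
    omega⟩
  have hodd : Odd (4 * m + 1) := ⟨2 * m, by ring⟩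
  rw [show (4 * m + 1 - 1) / 4 = m by omega]
  constructor
  · exact ratFuncModEq_qModulus hn1 hodd
      (fun d hd hd1 ζ hζ0 hζ => (hasVal_sub_closedFormG2 hζ0 hd hd1 hζ).1.vanishesTo_one)
      (fun ζ hζ0 hζ => (vanishesTo_sub_closedFormG2 hζ0 (by omega) hζ).1)
  · exact ratFuncModEq_qModulus hn1 hodd
      (fun d hd hd1 ζ hζ0 hζ => (hasVal_sub_closedFormG2 hζ0 hd hd1 hζ).2.vanishesTo_one)
      (fun ζ hζ0 hζ => (vanishesTo_sub_closedFormG2 hζ0 (by omega) hζ).2)
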